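/- Let $\log$ denote the logarithm to base $2$ and put $c=12/\log(3/2)+1$; then $c<22$. First order formulas are built from adjacency and equality of vertices with $\neg,\wedge,\vee,\exists,\forall$. The set of sequences of nested quantifiers of a formula consists of the empty word for an atomic formula; it is the union of the two sets for $\Phi\wedge\Psi$ and $\Phi\vee\Psi$; every sequence is prefixed by the quantifier for $\exists x\,\Phi$ and $\forall x\,\Phi$; and $\exists$ and $\forall$ are interchanged in every sequence for $\neg\Phi$. The quantifier rank of $\Phi$ is the maximum length of such a sequence, and the alternation number of $\Phi$ is the maximum number of occurrences of $\exists\forall$ and $\forall\exists$ as consecutive quantifiers in such a sequence. A closed formula $\Phi$ defines a graph $G$ if it is true on $G$ and false on every graph not isomorphic to $G$. Theorem. Let $G$ be a finite simple graph on $n$ vertices that has a Hamilton cycle, i.e. an ordering $v_1,\ldots,v_n$ of its vertices such that $v_i$ and $v_{i+1}$ are adjacent for all $i<n$ and $v_n$ and $v_1$ are adjacent, and that is outerplanar, i.e. can be embedded in the plane so that all vertices lie on the border of the same face. Then there is a closed first order formula $\Phi$ that defines $G$, has alternation number at most $2$, and has quantifier rank less than $c\log n+9$. -/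

import Mathlib

universe u w

/-! ### Outerplanar and Hamiltonian graphs -/

/-- An embedding of a graph in the plane: vertices are distinct points, an edge `uv` is an arc (a
homeomorphic image of `[0,1]`) joining the points of `u` and `v`, an arc contains no vertex other
than its two ends, and two different arcs meet at most in the points of common end vertices.
Values of `arc` at pairs that are not edges are irrelevant. -/
structure PlaneEmbedding {V : Type*} (G : SimpleGraph V) where
  pos : V → ℝ × ℝ
  pos_injective : Function.Injective pos
  arc : Sym2 V → Set (ℝ × ℝ)
  isArc : ∀ u v : V, G.Adj u v →
    ∃ γ : Path (pos u) (pos v), Function.Injective γ ∧ Set.range γ = arc s(u, v)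
  vertex_mem_arc : ∀ (v : V), ∀ e ∈ G.edgeSet, pos v ∈ arc e → v ∈ e
  arc_inter_arc : ∀ e ∈ G.edgeSet, ∀ f ∈ G.edgeSet, e ≠ f →
    ∀ x ∈ arc e ∩ arc f, ∃ v : V, v ∈ e ∧ v ∈ f ∧ x = pos v

namespace PlaneEmbedding

variable {V : Type*} {G : SimpleGraph V}

/-- The set of all points of the plane covered by the drawing. -/
def drawing (P : PlaneEmbedding G) : Set (ℝ × ℝ) :=
  Set.range P.pos ∪ ⋃ e ∈ G.edgeSet, P.arc e

/-- The faces are the connected components of the complement of the drawing. -/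
def IsFace (P : PlaneEmbedding G) (F : Set (ℝ × ℝ)) : Prop :=
  ∃ x ∈ (P.drawing)ᶜ, F = connectedComponentIn (P.drawing)ᶜ x

end PlaneEmbedding

/-- A graph is outerplanar if it can be embedded in the plane so that all its vertices lie on the
border of one face. -/
def Outerplanar {V : Type*} (G : SimpleGraph V) : Prop :=
  ∃ (P : PlaneEmbedding G) (F : Set (ℝ × ℝ)), P.IsFace F ∧ ∀ v : V, P.pos v ∈ frontier F

/-- The vertices can be listed without repetition as `v 0, …, v m` so that consecutive ones are
adjacent and the last one is adjacent to the first one (addition in `Fin (m + 1)` is cyclic). -/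
def HasHamiltonCycle {V : Type*} (G : SimpleGraph V) : Prop :=
  ∃ (m : ℕ) (v : Fin (m + 1) ≃ V), ∀ i : Fin (m + 1), G.Adj (v i) (v (i + 1))

/-! ### First order formulas over adjacency and equality -/

/-- First order formulas with connectives `¬, ∧, ∨` whose free variables are among
`x 0, …, x (n - 1)`; a quantifier in front of a formula with variables `x 0, …, x n` binds `x n`.
Closed formulas are those with `n = 0`. -/
inductive GraphFormula : ℕ → Type
  | adj {n : ℕ} (i j : Fin n) : GraphFormula n
  | equal {n : ℕ} (i j : Fin n) : GraphFormula n
  | neg {n : ℕ} (φ : GraphFormula n) : GraphFormula n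
  | and {n : ℕ} (φ ψ : GraphFormula n) : GraphFormula n
  | or {n : ℕ} (φ ψ : GraphFormula n) : GraphFormula n
  | ex {n : ℕ} (φ : GraphFormula (n + 1)) : GraphFormula n
  | all {n : ℕ} (φ : GraphFormula (n + 1)) : GraphFormula n

inductive Quantifier : Type
  | ex
  | all
  deriving DecidableEq

/-- The dual quantifier. -/
def Quantifier.dual : Quantifier → Quantifier
  | .ex => .all
  | .all => .ex

/-- The number of occurrences of `∃∀` and `∀∃` in a sequence of quantifiers. -/
def quantifierAlternations : List Quantifier → ℕ
  | [] => 0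
  | [_] => 0
  | a :: b :: s => (if a = b then 0 else 1) + quantifierAlternations (b :: s)

namespace GraphFormula

/-- Truth of a formula in a graph under an assignment of its variables. -/
def Realize {V : Type*} (G : SimpleGraph V) : {n : ℕ} → GraphFormula n → (Fin n → V) → Prop
  | _, adj i j, x => G.Adj (x i) (x j)
  | _, equal i j, x => x i = x j
  | _, neg φ, x => ¬ Realize G φ x
  | _, and φ ψ, x => Realize G φ x ∧ Realize G ψ x
  | _, or φ ψ, x => Realize G φ x ∨ Realize G ψ x
  | _, ex φ, x => ∃ a : V, Realize G φ (Fin.snoc x a)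
  | _, all φ, x => ∀ a : V, Realize G φ (Fin.snoc x a)

/-- The set of sequences of nested quantifiers of a formula; a negation dualizes the sequences. -/
def nest : {n : ℕ} → GraphFormula n → Finset (List Quantifier)
  | _, adj _ _ => {[]}
  | _, equal _ _ => {[]}
  | _, neg φ => (nest φ).image (List.map Quantifier.dual)
  | _, and φ ψ => nest φ ∪ nest ψ
  | _, or φ ψ => nest φ ∪ nest ψ
  | _, ex φ => (nest φ).image (List.cons Quantifier.ex)
  | _, all φ => (nest φ).image (List.cons Quantifier.all)

/-- The maximum length of a sequence of nested quantifiers. -/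
def quantifierRank {n : ℕ} (φ : GraphFormula n) : ℕ :=
  φ.nest.sup List.length

/-- The maximum number of alternations in a sequence of nested quantifiers. -/
def alternationNumber {n : ℕ} (φ : GraphFormula n) : ℕ :=
  φ.nest.sup quantifierAlternations

/-- Truth of a closed formula on a graph. -/
def TrueOn {V : Type*} (Φ : GraphFormula 0) (G : SimpleGraph V) : Prop :=
  Φ.Realize G Fin.elim0

/-- A closed formula defines `G` if it is true on `G` and false on every graph `G'` (finite or
infinite, with vertices in an arbitrary universe `w`) that is not isomorphic to `G`. -/
def Defines {V : Type u} (Φ : GraphFormula 0) (G : SimpleGraph V) : Prop :=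
  Φ.TrueOn G ∧
    ∀ (V' : Type w) (G' : SimpleGraph V'), ¬ Nonempty (G ≃g G') → ¬ Φ.TrueOn G'

end GraphFormula

/-!
# Logarithmic depth of outerplanar graphs with a Hamilton cycle

*Topology.* Number the vertices along the Hamilton cycle. If two edges crossed in this cyclic order,
the cycle and the two edges would form a subdivision of `K₄` in which all four branch vertices lie
on the border of one face. A new vertex in that face can be joined to each branch vertex by a curve
that runs in the face up to a small disc around the branch vertex, so it misses all edges of `K₄`
which do not contain that branch vertex. The result is a drawing of `K₅` where vertex-disjoint edges
do not meet. This is impossible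
(`not_exists_disjoint_drawing_completeGraph_five`): for disjoint edges `ij` and `kl`, the difference
of the two curves is a nowhere vanishing function of two parameters, hence has a continuous
logarithm, which gives one linear relation between integers. Each integer occurs an even number of
times in the sum of all 15 relations, while the remaining terms count the crossing pairs of edges of
a convex pentagon with its diagonals, an odd number.

*Logic.* Suppose a part `A` of `G` is separated from the rest by vertices that are already
quantified. It is cut by a few more vertices `U` into smaller parts `A₁, A₂, …`, and in each
component of these a representative is chosen. The formula for `A` quantifies these vertices
existentially and says that they span the right induced subgraph, that representatives of different
parts are not joined outside `U`, that each vertex joined to a representative of `A` is in `U` or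
joined to a representative of a smaller part, and that the smaller parts satisfy their own formulas
(`PieceDefinable.of_cut`). The second condition makes the embeddings of the smaller parts in a graph
`G'` satisfying the formula fit together to an embedding of `A`. The third condition shows that the
embedding of `G` is onto. Being joined by a walk of length at most `2 ^ k` is
expressed by `k` nested existential quantifiers, where `2 ^ k ≥ 2 n` suffices. So all sequences of
nested quantifiers have the form `∃*∀*∃*`, and the rank is the depth of the decomposition plus
`log n + O(1)`.

*Combinatorics.* Pairs of vertices crossed by no edge cut a polygon into strips between two nested
pairs. By `StripDefinable.of_strip` and `StripDefinable.of_interval`, two rounds with six new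
vertices each (three cutting vertices and three representatives) reduce the width of the strips
to one half. The rank obtained in this way is less than `13 log n`, and
`13 ≤ 12 / log (3 / 2) + 1` because `log (3 / 2) ≤ 1`.
-/

/-! ### Vertex-disjoint edges of a plane drawing of `K₅` meet -/

/-- A continuous nowhere vanishing function on a simply connected space has a continuous
logarithm. -/
lemma exists_continuous_exp_eq {A : Type*} [TopologicalSpace A] [SimplyConnectedSpace A]
    [LocallyPathConnectedSpace A] {f : A → ℂ} (hf : Continuous f) (h0 : ∀ a, f a ≠ 0) :
    ∃ L : A → ℂ, Continuous L ∧ ∀ a, Complex.exp (L a) = f a := by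
  obtain ⟨a₀⟩ : Nonempty A := inferInstance
  obtain ⟨F, ⟨-, hF⟩, -⟩ := Complex.isCoveringMapOn_exp.existsUnique_continuousMap_lifts
    ⟨f, hf⟩ (a₀ := a₀) (e₀ := Complex.log (f a₀)) (Complex.exp_log (h0 a₀)) (fun a ↦ h0 a)
  exact ⟨F, F.continuous, fun a ↦ congrFun hF a⟩

/-- Two continuous logarithms of the same function differ by a constant. -/
lemma sub_eq_sub_of_exp_eq {L M : ℝ → ℂ} (hL : Continuous L) (hM : Continuous M)
    (h : ∀ s, Complex.exp (L s) = Complex.exp (M s)) (s t : ℝ) : L s - L t = M s - M t := by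
  have key : (fun s ↦ L s - L t) = fun s ↦ M s - M t := by
    refine Complex.isCoveringMap_exp.eq_of_comp_eq (by fun_prop) (by fun_prop) ?_ t (by simp)
    funext s
    simp [Complex.exp_sub, h]
  exact congrFun key s

/-- The points of a drawing of `K₅` in the plane are given by `p`, and `γ i j` with `i < j` is a
curve from `p i` to `p j`, parametrized over `[0, 1]` and extended to `ℝ`. Curves of vertex-disjoint
edges cannot all be disjoint.

For `v ∉ {i, j}` the increment along `γ i j` of a continuous logarithm of `γ i j - p v` equals the
difference of fixed logarithms of `p j - p v` and `p i - p v` up to an integer multiple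
`n v i j` of `2πi`. A continuous logarithm of `γ i j s - γ k l t` on the plane of the
parameters `(s, t)` relates the four increments of the pair `ij`, `kl`. The sum
of the `15` resulting equations is contradictory modulo `2`. -/
theorem not_exists_disjoint_drawing_completeGraph_five (p : Fin 5 → ℂ)
    (γ : Fin 5 → Fin 5 → ℝ → ℂ) (hc : ∀ i j, i < j → Continuous (γ i j))
    (h0 : ∀ i j, i < j → γ i j 0 = p i) (h1 : ∀ i j, i < j → γ i j 1 = p j)
    (hd : ∀ i j k l, i < j → k < l → i ≠ k → i ≠ l → j ≠ k → j ≠ l →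
      ∀ s t, γ i j s ≠ γ k l t) : False := by
  -- a vertex avoids the edges it does not belong to, as it is an end of a disjoint edge
  have hpγ : ∀ v i j, i < j → v ≠ i → v ≠ j → ∀ s, γ i j s ≠ p v := by
    intro v i j hij hvi hvj s
    obtain ⟨w, hwv, hwi, hwj⟩ : ∃ w : Fin 5, w ≠ v ∧ w ≠ i ∧ w ≠ j := by
      clear hij hvi hvj; revert v i j; decide
    rcases lt_or_gt_of_ne hwv with h | h
    · rw [← h1 w v h]; exact hd i j w v hij h hwi.symm hvi.symm hwj.symm hvj.symm s 1
    · rw [← h0 v w h]; exact hd i j v w hij h hvi.symm hwi.symm hvj.symm hwj.symm s 0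
  have hpp : ∀ u v, u ≠ v → p v - p u ≠ 0 := by
    intro u v huv
    obtain ⟨w, hwu, hwv⟩ : ∃ w : Fin 5, w ≠ u ∧ w ≠ v := by
      clear huv; revert u v; decide
    rw [sub_ne_zero]
    rcases lt_or_gt_of_ne hwv with h | h
    · rw [← h1 w v h]; exact hpγ u w v h hwu.symm huv 1
    · rw [← h0 v w h]; exact hpγ u v w h huv hwu.symm 0
  -- `A u v` is a logarithm of `p v - p u`, chosen such that `A v u = A u v + πi` for `u < v`
  set σ : Fin 5 → Fin 5 → ℤ := fun u v ↦ if u < v then 0 else 1 with hσ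
  set B : Fin 5 → Fin 5 → ℂ := fun u v ↦ Complex.log (p (max u v) - p (min u v)) with hB
  set A : Fin 5 → Fin 5 → ℂ := fun u v ↦ B u v + Real.pi * Complex.I * σ u v with hA
  have hBs : ∀ u v, B u v = B v u := fun u v ↦ by simp only [hB, max_comm, min_comm]
  have hAexp : ∀ u v, u ≠ v → Complex.exp (A u v) = p v - p u := by
    intro u v huv
    rcases lt_or_gt_of_ne huv with h | h
    · have : A u v = Complex.log (p v - p u) := by simp [hA, hB, hσ, h, h.le]
      rw [this, Complex.exp_log (hpp u v huv)]
    · have : A u v = Complex.log (p u - p v) + Real.pi * Complex.I := by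
        simp [hA, hB, hσ, h.le, h.not_gt]
      rw [this, Complex.exp_add, Complex.exp_log (hpp v u huv.symm), Complex.exp_pi_mul_I]
      ring
  have hn : ∀ v i j, ∃ n : ℤ, i < j → v ≠ i → v ≠ j → ∀ L : ℝ → ℂ, Continuous L →
      (∀ s, Complex.exp (L s) = γ i j s - p v) →
      L 1 - L 0 = A v j - A v i + n * (2 * Real.pi * Complex.I) := by
    intro v i j
    by_cases H : i < j ∧ v ≠ i ∧ v ≠ j
    · obtain ⟨hij, hvi, hvj⟩ := H
      obtain ⟨L, hL, hLe⟩ := exists_continuous_exp_eq (f := fun s ↦ γ i j s - p v)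
        ((hc i j hij).sub continuous_const) (fun s ↦ sub_ne_zero.2 (hpγ v i j hij hvi hvj s))
      have hz : Complex.exp (L 1 - L 0) = Complex.exp (A v j - A v i) := by
        rw [Complex.exp_sub, Complex.exp_sub, hLe, hLe, hAexp v j hvj, hAexp v i hvi, h0 i j hij,
          h1 i j hij]
      obtain ⟨n, hn⟩ := Complex.exp_eq_exp_iff_exists_int.1 hz
      refine ⟨n, fun _ _ _ M hM hMe ↦ ?_⟩
      rw [← hn]
      exact sub_eq_sub_of_exp_eq hM hL (fun s ↦ (hMe s).trans (hLe s).symm) 1 0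
    · exact ⟨0, fun a b c ↦ absurd ⟨a, b, c⟩ H⟩
  choose n hn using hn
  -- the sides of the unit square of the parameters give the logarithms of four curves minus a point,
  -- and two of these change sign, which adds `πi` to the logarithm
  have key : ∀ i j k l, i < j → k < l → i ≠ k → i ≠ l → j ≠ k → j ≠ l →
      σ k j - σ k i - σ l j + σ l i + 2 * (n k i j - n l i j) =
      σ i l - σ i k - σ j l + σ j k + 2 * (n i k l - n j k l) := by
    intro i j k l hij hkl hik hil hjk hjl
    obtain ⟨H, hH, hHe⟩ := exists_continuous_exp_eq
      (f := fun x : ℝ × ℝ ↦ γ i j x.1 - γ k l x.2)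
      (((hc i j hij).comp continuous_fst).sub ((hc k l hkl).comp continuous_snd))
      (fun x ↦ sub_ne_zero.2 (hd i j k l hij hkl hik hil hjk hjl _ _))
    have e1 := hn k i j hij hik.symm hjk.symm (fun s ↦ H (s, 0)) (by fun_prop)
      (fun s ↦ by rw [hHe, h0 k l hkl])
    have e2 := hn l i j hij hil.symm hjl.symm (fun s ↦ H (s, 1)) (by fun_prop)
      (fun s ↦ by rw [hHe, h1 k l hkl])
    have e3 := hn i k l hkl hik hil (fun t ↦ H (0, t) + Real.pi * Complex.I) (by fun_prop)
      (fun t ↦ by rw [Complex.exp_add, hHe, h0 i j hij, Complex.exp_pi_mul_I]; ring)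
    have e4 := hn j k l hkl hjk hjl (fun t ↦ H (1, t) + Real.pi * Complex.I) (by fun_prop)
      (fun t ↦ by rw [Complex.exp_add, hHe, h1 i j hij, Complex.exp_pi_mul_I]; ring)
    have hpi : (Real.pi * Complex.I : ℂ) ≠ 0 := by simp [Real.pi_ne_zero]
    have hC : (Real.pi * Complex.I : ℂ) *
        ((σ k j - σ k i - σ l j + σ l i + 2 * (n k i j - n l i j) : ℤ) : ℂ) =
        (Real.pi * Complex.I : ℂ) *
        ((σ i l - σ i k - σ j l + σ j k + 2 * (n i k l - n j k l) : ℤ) : ℂ) := by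
      simp only [hA] at e1 e2 e3 e4
      push_cast
      linear_combination e2 - e1 + e3 - e4 - hBs k j + hBs k i + hBs l j - hBs l i
    exact_mod_cast mul_left_cancel₀ hpi hC
  -- every `n v i j` occurs in two of the equations
  have e0123 := key 0 1 2 3
  have e0124 := key 0 1 2 4
  have e0134 := key 0 1 3 4
  have e0213 := key 0 2 1 3
  have e0214 := key 0 2 1 4
  have e0234 := key 0 2 3 4
  have e0312 := key 0 3 1 2
  have e0314 := key 0 3 1 4
  have e0324 := key 0 3 2 4
  have e0412 := key 0 4 1 2
  have e0413 := key 0 4 1 3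
  have e0423 := key 0 4 2 3
  have e1234 := key 1 2 3 4
  have e1324 := key 1 3 2 4
  have e1423 := key 1 4 2 3
  simp [hσ] at e0123 e0124 e0134 e0213 e0214 e0234 e0312 e0314
  simp [hσ] at e0324 e0412 e0413 e0423 e1234 e1324 e1423
  omega

/-- The version of `not_exists_disjoint_drawing_completeGraph_five` where curves are replaced by
sets in which the ends of the edges can be joined. -/
lemma not_exists_disjoint_joinedIn_five (p : Fin 5 → ℝ × ℝ) (S : Fin 5 → Fin 5 → Set (ℝ × ℝ))
    (hJ : ∀ i j, i < j → JoinedIn (S i j) (p i) (p j))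
    (hd : ∀ i j k l, i < j → k < l → i ≠ k → i ≠ l → j ≠ k → j ≠ l →
      Disjoint (S i j) (S k l)) : False := by
  let e : (ℝ × ℝ) ≃L[ℝ] ℂ := Complex.equivRealProdCLM.symm
  choose γ hγ using hJ
  refine not_exists_disjoint_drawing_completeGraph_five (fun i ↦ e (p i))
    (fun i j s ↦ if h : i < j then e ((γ i j h).extend s) else 0) ?_ ?_ ?_ ?_
  · intro i j h
    simp only [h, dif_pos]
    exact e.continuous.comp (γ i j h).continuous_extend
  · intro i j h; simp [h]
  · intro i j h; simp [h]
  · intro i j k l hij hkl hik hil hjk hjl s t heq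
    simp only [hij, hkl, dif_pos] at heq
    have hmem : ∀ i j (h : i < j) (s : ℝ), (γ i j h).extend s ∈ S i j := by
      intro i j h s
      obtain ⟨t, ht⟩ : (γ i j h).extend s ∈ Set.range (γ i j h) := by
        rw [← Path.extend_range]; exact ⟨s, rfl⟩
      rw [← ht]; exact hγ i j h t
    exact Set.disjoint_left.1 (hd i j k l hij hkl hik hil hjk hjl) (hmem i j hij s)
      (e.injective heq ▸ hmem k l hkl t)

/-- A point in the closure of a connected open set `F` can be joined with the points of `F` while
avoiding a given closed set that contains neither. -/
lemma joinedIn_compl_of_mem_closure {F K : Set (ℝ × ℝ)} (hFo : IsOpen F) (hFc : IsConnected F)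
    (hK : IsClosed K) (hFK : Disjoint F K) {o q : ℝ × ℝ} (ho : o ∈ F) (hq : q ∈ closure F)
    (hqK : q ∉ K) : JoinedIn Kᶜ o q := by
  obtain ⟨ε, hε, hball⟩ := Metric.isOpen_iff.1 hK.isOpen_compl q hqK
  obtain ⟨y, hyF, hy⟩ := Metric.mem_closure_iff.1 hq ε hε
  have h1 : JoinedIn F o y :=
    (hFo.isConnected_iff_isPathConnected.1 hFc).joinedIn o ho y hyF
  have h2 : JoinedIn (Metric.ball q ε) y q :=
    ((convex_ball q ε).isPathConnected ⟨q, Metric.mem_ball_self hε⟩).joinedIn y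
      (by rwa [Metric.mem_ball, dist_comm]) q (Metric.mem_ball_self hε)
  exact (h1.mono (Set.disjoint_left.1 hFK)).trans (h2.mono hball)

/-- A plane drawing of `K₄` does not have all four vertices on the border of one face: a further
vertex in that face would extend it to a drawing of `K₅`. -/
theorem not_exists_disjoint_drawing_completeGraph_four (q : Fin 4 → ℝ × ℝ)
    (S : Fin 4 → Fin 4 → Set (ℝ × ℝ)) (hS : ∀ i j, i < j → IsClosed (S i j))
    (hJ : ∀ i j, i < j → JoinedIn (S i j) (q i) (q j))
    (hd : ∀ i j k l, i < j → k < l → i ≠ k → i ≠ l → j ≠ k → j ≠ l →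
      Disjoint (S i j) (S k l))
    {F : Set (ℝ × ℝ)} (hFo : IsOpen F) (hFc : IsConnected F)
    (hFS : ∀ i j, i < j → Disjoint F (S i j)) (hqF : ∀ i, q i ∈ closure F) : False := by
  obtain ⟨o, ho⟩ := hFc.nonempty
  have hqS : ∀ v i j, i < j → v ≠ i → v ≠ j → q v ∉ S i j := by
    intro v i j hij hvi hvj hv
    obtain ⟨w, hwv, hwi, hwj⟩ : ∃ w : Fin 4, w ≠ v ∧ w ≠ i ∧ w ≠ j := by
      clear hij hvi hvj hv; revert v i j; decide
    rcases lt_or_gt_of_ne hwv with h | h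
    · exact Set.disjoint_left.1 (hd w v i j h hij hwi hwj hvi hvj) (hJ w v h).target_mem hv
    · exact Set.disjoint_left.1 (hd v w i j h hij hvi hvj hwi hwj) (hJ v w h).source_mem hv
  -- the union of the edges that do not contain the vertex `v`
  let K : Fin 4 → Set (ℝ × ℝ) := fun v ↦
    ⋃ e ∈ {e : Fin 4 × Fin 4 | e.1 < e.2 ∧ v ≠ e.1 ∧ v ≠ e.2}, S e.1 e.2
  have hK : ∀ v i j, i < j → v ≠ i → v ≠ j → S i j ⊆ K v := fun v i j h1 h2 h3 ↦
    Set.subset_biUnion_of_mem (u := fun e : Fin 4 × Fin 4 ↦ S e.1 e.2)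
      (show (i, j) ∈ {e : Fin 4 × Fin 4 | e.1 < e.2 ∧ v ≠ e.1 ∧ v ≠ e.2} from ⟨h1, h2, h3⟩)
  have hoJ : ∀ v, JoinedIn (K v)ᶜ o (q v) := fun v ↦ by
    refine joinedIn_compl_of_mem_closure hFo hFc ?_ ?_ ho (hqF v) ?_
    · exact (Set.toFinite _).isClosed_biUnion fun e he ↦ hS _ _ he.1
    · exact Set.disjoint_iUnion₂_right.2 fun e he ↦ hFS _ _ he.1
    · simp only [K, Set.mem_iUnion, not_exists]
      exact fun e he ↦ hqS _ _ _ he.1 he.2.1 he.2.2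
  refine not_exists_disjoint_joinedIn_five (Fin.cons o q)
    (fun i j ↦ Fin.cases (Fin.cases ∅ (fun j ↦ (K j)ᶜ) j)
      (fun i ↦ Fin.cases ∅ (fun j ↦ S i j) j) i) ?_ ?_
  · intro i j hij
    cases j using Fin.cases with
    | zero => simp at hij
    | succ j =>
      cases i using Fin.cases with
      | zero => simpa using hoJ j
      | succ i => simpa using hJ i j (Fin.succ_lt_succ_iff.1 hij)
  · intro i j k l hij hkl hik hil hjk hjl
    cases j using Fin.cases with
    | zero => simp at hij
    | succ j =>
    cases l using Fin.cases with
    | zero => simp at hkl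
    | succ l =>
    cases i using Fin.cases with
    | zero =>
      cases k using Fin.cases with
      | zero => simp at hik
      | succ k =>
        simp only [Fin.cases_zero, Fin.cases_succ]
        exact (Set.disjoint_compl_left_iff_subset).2 (hK j k l (Fin.succ_lt_succ_iff.1 hkl)
          (fun h ↦ hjk (by rw [h])) (fun h ↦ hjl (by rw [h])))
    | succ i =>
      cases k using Fin.cases with
      | zero =>
        simp only [Fin.cases_zero, Fin.cases_succ]
        exact (Set.disjoint_compl_right_iff_subset).2 (hK l i j (Fin.succ_lt_succ_iff.1 hij)
          (fun h ↦ hil (by rw [h])) (fun h ↦ hjl (by rw [h])))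
      | succ k =>
        simp only [Fin.cases_succ]
        exact hd i j k l (Fin.succ_lt_succ_iff.1 hij) (Fin.succ_lt_succ_iff.1 hkl)
          (fun h ↦ hik (by rw [h])) (fun h ↦ hil (by rw [h])) (fun h ↦ hjk (by rw [h]))
          (fun h ↦ hjl (by rw [h]))

/-! ### Chords of a Hamilton cycle of an outerplanar graph do not cross -/

namespace PlaneEmbedding

variable {V : Type*} {G : SimpleGraph V} (P : PlaneEmbedding G)

/-- The part of a plane drawing covered by a walk. -/
def walkSet {u v : V} (p : G.Walk u v) : Set (ℝ × ℝ) :=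
  P.pos '' {w | w ∈ p.support} ∪ ⋃ e ∈ {e | e ∈ p.edges}, P.arc e

variable {P}

lemma isClosed_arc {e : Sym2 V} (he : e ∈ G.edgeSet) : IsClosed (P.arc e) := by
  induction e with
  | h u v =>
    obtain ⟨γ, -, hγ⟩ := P.isArc u v he
    rw [← hγ]
    exact (isCompact_range γ.continuous).isClosed

lemma isClosed_walkSet {u v : V} (p : G.Walk u v) : IsClosed (P.walkSet p) := by
  refine ((p.support.finite_toSet).image _).isClosed.union ?_
  exact p.edges.finite_toSet.isClosed_biUnion fun e he ↦
    P.isClosed_arc (p.edges_subset_edgeSet he)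

lemma walkSet_subset_drawing {u v : V} (p : G.Walk u v) : P.walkSet p ⊆ P.drawing :=
  Set.union_subset_union (Set.image_subset_range _ _)
    (Set.biUnion_subset_biUnion_left fun _ he ↦ p.edges_subset_edgeSet he)

lemma joinedIn_walkSet {u v : V} (p : G.Walk u v) :
    JoinedIn (P.walkSet p) (P.pos u) (P.pos v) := by
  induction p with
  | nil => exact JoinedIn.refl (Or.inl ⟨_, by simp, rfl⟩)
  | @cons u v w h p ih =>
    have h2 : P.walkSet p ⊆ P.walkSet (SimpleGraph.Walk.cons h p) := by
      refine Set.union_subset_union (Set.image_mono fun x hx ↦ ?_)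
        (Set.biUnion_subset_biUnion_left fun e he ↦ ?_)
      · simpa using Or.inr hx
      · simpa using Or.inr he
    refine JoinedIn.trans ?_ (ih.mono h2)
    obtain ⟨γ, -, hγ⟩ := P.isArc u v h
    refine ⟨γ, fun t ↦ Or.inr ?_⟩
    have ht : γ t ∈ P.arc s(u, v) := hγ ▸ ⟨t, rfl⟩
    simp only [Set.mem_iUnion]
    exact ⟨s(u, v), by simp, ht⟩

lemma disjoint_walkSet {u v u' v' : V} (p : G.Walk u v) (q : G.Walk u' v')
    (h : p.support.Disjoint q.support) : Disjoint (P.walkSet p) (P.walkSet q) := by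
  have hmem : ∀ {a b : V} (r : G.Walk a b) {e : Sym2 V} {w : V}, e ∈ r.edges → w ∈ e →
      w ∈ r.support := by
    intro a b r e w he hw
    induction e with
    | h x y =>
      rcases Sym2.mem_iff.1 hw with rfl | rfl
      · exact r.fst_mem_support_of_mem_edges he
      · exact r.snd_mem_support_of_mem_edges he
  rw [Set.disjoint_left]
  rintro x (⟨w, hw, rfl⟩ | hx) (⟨w', hw', hww⟩ | hx')
  · exact h hw (P.pos_injective hww ▸ hw')
  · simp only [Set.mem_iUnion] at hx'
    obtain ⟨e, he, hx'⟩ := hx'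
    exact h hw (hmem q he (P.vertex_mem_arc w e (q.edges_subset_edgeSet he) hx'))
  · simp only [Set.mem_iUnion] at hx
    obtain ⟨e, he, hx⟩ := hx
    exact h (hmem p he (P.vertex_mem_arc w' e (p.edges_subset_edgeSet he) (hww ▸ hx))) hw'
  · simp only [Set.mem_iUnion] at hx hx'
    obtain ⟨e, he, hx⟩ := hx
    obtain ⟨f, hf, hx'⟩ := hx'
    by_cases hef : e = f
    · subst hef
      induction e with
      | h a b =>
        exact h (p.fst_mem_support_of_mem_edges he) (q.fst_mem_support_of_mem_edges hf)
    · obtain ⟨w, hwe, hwf, -⟩ := P.arc_inter_arc e (p.edges_subset_edgeSet he) f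
        (q.edges_subset_edgeSet hf) hef x ⟨hx, hx'⟩
      exact h (hmem p he hwe) (hmem q hf hwf)

lemma isClosed_drawing [Finite V] : IsClosed P.drawing :=
  (Set.finite_range _).isClosed.union
    ((Set.toFinite _).isClosed_biUnion fun _ he ↦ P.isClosed_arc he)

end PlaneEmbedding

/-- An outerplanar graph contains no subdivision of `K₄`. -/
theorem Outerplanar.not_subdivision_completeGraph_four {V : Type*} [Finite V] {G : SimpleGraph V}
    (hG : Outerplanar G) {a b c d : V} (ab : G.Walk a b) (bc : G.Walk b c) (cd : G.Walk c d)
    (ad : G.Walk a d) (ac : G.Walk a c) (bd : G.Walk b d)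
    (h1 : ab.support.Disjoint cd.support) (h2 : ad.support.Disjoint bc.support)
    (h3 : ac.support.Disjoint bd.support) : False := by
  obtain ⟨P, F, ⟨x, hx, rfl⟩, hF⟩ := hG
  have h1' := P.disjoint_walkSet ab cd h1
  have h2' := P.disjoint_walkSet ad bc h2
  have h3' := P.disjoint_walkSet ac bd h3
  have hsub : connectedComponentIn P.drawingᶜ x ⊆ P.drawingᶜ := connectedComponentIn_subset _ _
  have hFd : ∀ {u v : V} (p : G.Walk u v),
      Disjoint (connectedComponentIn P.drawingᶜ x) (P.walkSet p) := fun p ↦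
    (Set.disjoint_compl_left_iff_subset.2 (P.walkSet_subset_drawing p)).mono_left hsub
  refine not_exists_disjoint_drawing_completeGraph_four ![P.pos a, P.pos b, P.pos c, P.pos d]
    ![![∅, P.walkSet ab, P.walkSet ac, P.walkSet ad], ![∅, ∅, P.walkSet bc, P.walkSet bd],
      ![∅, ∅, ∅, P.walkSet cd], ![∅, ∅, ∅, ∅]] ?_ ?_ ?_
    (F := connectedComponentIn P.drawingᶜ x) P.isClosed_drawing.isOpen_compl.connectedComponentIn
    (isConnected_connectedComponentIn_iff.2 hx) ?_ ?_
  · intro i j hij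
    fin_cases i <;> fin_cases j <;> first | exact P.isClosed_walkSet _ | simp at hij
  · intro i j hij
    fin_cases i <;> fin_cases j <;> first | exact P.joinedIn_walkSet _ | simp at hij
  · intro i j k l hij hkl hik hil hjk hjl
    fin_cases i <;> fin_cases j <;> first | (exfalso; revert hij; decide) | skip
    all_goals
      fin_cases k <;> fin_cases l <;>
        first
          | (exfalso; revert hkl hik hil hjk hjl; decide)
          | assumption
          | (apply Disjoint.symm; assumption)
  · intro i j hij
    fin_cases i <;> fin_cases j <;> first | exact hFd _ | simp at hij
  · intro i
    fin_cases i <;> exact frontier_subset_closure (hF _)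

/-- The function `ℓ` numbers the vertices of `G` by `0, …, n - 1` along a Hamilton path, and no two
edges of `G` cross when the vertices are placed on a circle in this order. -/
structure IsPolygonLabelling {V : Type*} (G : SimpleGraph V) (n : ℕ) (ℓ : V → ℕ) : Prop where
  injective : Function.Injective ℓ
  lt : ∀ u, ℓ u < n
  exists_eq : ∀ i < n, ∃ u, ℓ u = i
  adj_of_eq_succ : ∀ u v, ℓ v = ℓ u + 1 → G.Adj u v
  not_cross : ∀ a b c d, ℓ a < ℓ b → ℓ b < ℓ c → ℓ c < ℓ d → G.Adj a c → ¬ G.Adj b d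

/-- A walk along a numbered Hamilton path. -/
lemma exists_walk_support_between {V : Type*} {G : SimpleGraph V} {n : ℕ} {ℓ : V → ℕ}
    (hi : Function.Injective ℓ) (hlt : ∀ u, ℓ u < n) (hex : ∀ i < n, ∃ u, ℓ u = i)
    (hadj : ∀ u v, ℓ v = ℓ u + 1 → G.Adj u v) {u v : V} (huv : ℓ u ≤ ℓ v) :
    ∃ p : G.Walk u v, ∀ w ∈ p.support, ℓ u ≤ ℓ w ∧ ℓ w ≤ ℓ v := by
  obtain ⟨k, hk⟩ := Nat.exists_eq_add_of_le huv
  induction k generalizing u with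
  | zero =>
    obtain rfl := hi hk
    exact ⟨.nil, by simp⟩
  | succ k ih =>
    obtain ⟨u', hu'⟩ := hex (ℓ u + 1) (by have := hlt v; omega)
    obtain ⟨p, hp⟩ := ih (u := u') (by omega) (by omega)
    refine ⟨.cons (hadj u u' hu') p, fun w hw ↦ ?_⟩
    rw [SimpleGraph.Walk.support_cons, List.mem_cons] at hw
    rcases hw with rfl | hw
    · omega
    · have := hp w hw; omega

theorem HasHamiltonCycle.exists_isPolygonLabelling {V : Type*} [Fintype V] {G : SimpleGraph V}
    (hH : HasHamiltonCycle G) (hO : Outerplanar G) :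
    2 ≤ Fintype.card V ∧ ∃ ℓ : V → ℕ, IsPolygonLabelling G (Fintype.card V) ℓ := by
  obtain ⟨m, e, he⟩ := hH
  have hcard : Fintype.card V = m + 1 := by simpa using (Fintype.card_congr e).symm
  rw [hcard]
  refine ⟨?_, fun u ↦ (e.symm u : ℕ), ?_⟩
  · rcases m with _ | m
    · have h := he 0
      exact absurd h (by simp [Fin.fin_one_eq_zero])
    · omega
  set ℓ : V → ℕ := fun u ↦ (e.symm u : ℕ) with hℓ
  have hi : Function.Injective ℓ := fun u v h ↦ e.symm.injective (Fin.ext h)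
  have hlt : ∀ u, ℓ u < m + 1 := fun u ↦ (e.symm u).2
  have hex : ∀ i < m + 1, ∃ u, ℓ u = i := fun i h ↦ ⟨e ⟨i, h⟩, by simp [hℓ]⟩
  have hadj : ∀ u v, ℓ v = ℓ u + 1 → G.Adj u v := by
    intro u v h
    have h1 := he (e.symm u)
    have h2 : e.symm u + 1 = e.symm v := by
      apply Fin.ext
      have h3 : (e.symm u : ℕ) + 1 < m + 1 := h ▸ hlt v
      rw [Fin.val_add_one_of_lt' h3]
      exact h.symm
    rw [h2] at h1
    simpa using h1
  refine ⟨hi, hlt, hex, hadj, fun a b c d hab hbc hcd hac hbd ↦ ?_⟩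
  have hwalk := @exists_walk_support_between V G (m + 1) ℓ hi hlt hex hadj
  obtain ⟨ab, hab'⟩ := hwalk hab.le
  obtain ⟨bc, hbc'⟩ := hwalk hbc.le
  obtain ⟨cd, hcd'⟩ := hwalk hcd.le
  -- the walk from `a` to `d` passes the edge between the last and the first vertex
  obtain ⟨za, hza⟩ := hwalk (u := e 0) (v := a) (by simp [hℓ])
  obtain ⟨dl, hdl⟩ := hwalk (u := d) (v := e (Fin.last m)) (by have := hlt d; simp [hℓ]; omega)
  have hlast : G.Adj (e 0) (e (Fin.last m)) := by simpa using (he (Fin.last m)).symm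
  have had : ∀ w ∈ (za.reverse.append (.cons hlast dl.reverse)).support,
      ℓ w ≤ ℓ a ∨ ℓ d ≤ ℓ w := by
    intro w hw
    simp only [SimpleGraph.Walk.mem_support_append_iff, SimpleGraph.Walk.support_cons,
      SimpleGraph.Walk.support_reverse, List.mem_cons, List.mem_reverse] at hw
    rcases hw with hw | rfl | hw
    · exact Or.inl (hza w hw).2
    · exact Or.inl (by simp [hℓ])
    · exact Or.inr (hdl w hw).1
  refine hO.not_subdivision_completeGraph_four ab bc cd
    (za.reverse.append (.cons hlast dl.reverse)) hac.toWalk hbd.toWalk ?_ ?_ ?_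
  · intro w h1 h2
    have := hab' w h1; have := hcd' w h2; omega
  · intro w h1 h2
    have := had w h1; have := hbc' w h2; omega
  · intro w h1 h2
    simp only [SimpleGraph.Walk.support_cons, SimpleGraph.Walk.support_nil,
      List.mem_cons, List.not_mem_nil, or_false] at h1 h2
    rcases h1 with h1 | h1 <;> rcases h2 with h2 | h2 <;>
      have := congrArg ℓ (h1.symm.trans h2) <;> omega

/-! ### Quantifier sequences of formulas -/

namespace GraphFormula

variable {m : ℕ}

/-- Every sequence of nested quantifiers of `φ` has length at most `ρ`, and at most `j` alternations
when it is prefixed with the quantifier `q`. -/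
def QBound (q : Quantifier) (j ρ : ℕ) (φ : GraphFormula m) : Prop :=
  ∀ s ∈ φ.nest, quantifierAlternations (q :: s) ≤ j ∧ s.length ≤ ρ

lemma quantifierAlternations_cons_le (q q' : Quantifier) (s : List Quantifier) :
    quantifierAlternations (q' :: s) ≤ quantifierAlternations (q :: s) + 1 := by
  cases s with
  | nil => simp [quantifierAlternations]
  | cons b s => simp only [quantifierAlternations]; split_ifs <;> omega

lemma quantifierAlternations_le_cons (q : Quantifier) (s : List Quantifier) :
    quantifierAlternations s ≤ quantifierAlternations (q :: s) := by
  cases s with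
  | nil => simp [quantifierAlternations]
  | cons b s => simp [quantifierAlternations]

lemma quantifierAlternations_map_dual (s : List Quantifier) :
    quantifierAlternations (s.map Quantifier.dual) = quantifierAlternations s := by
  induction s with
  | nil => rfl
  | cons a s ih =>
    cases s with
    | nil => rfl
    | cons b s =>
      simp only [List.map_cons, quantifierAlternations] at ih ⊢
      rw [ih]
      cases a <;> cases b <;> simp [Quantifier.dual]

variable {q : Quantifier} {j ρ : ℕ}

lemma QBound.mono {φ : GraphFormula m} (h : QBound q j ρ φ) {j' ρ' : ℕ} (hj : j ≤ j')
    (hρ : ρ ≤ ρ') : QBound q j' ρ' φ :=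
  fun s hs ↦ ⟨(h s hs).1.trans hj, (h s hs).2.trans hρ⟩

lemma QBound.switch {φ : GraphFormula m} (h : QBound q j ρ φ) (q' : Quantifier) :
    QBound q' (j + 1) ρ φ :=
  fun s hs ↦ ⟨(quantifierAlternations_cons_le q q' s).trans (by have := (h s hs).1; omega),
    (h s hs).2⟩

lemma QBound.adj (i i' : Fin m) : QBound q j ρ (.adj i i') := by
  intro s hs
  simp only [nest, Finset.mem_singleton] at hs
  simp [hs, quantifierAlternations]

lemma QBound.equal (i i' : Fin m) : QBound q j ρ (.equal i i') := by
  intro s hs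
  simp only [nest, Finset.mem_singleton] at hs
  simp [hs, quantifierAlternations]

lemma QBound.neg {φ : GraphFormula m} (h : QBound q j ρ φ) : QBound q.dual j ρ φ.neg := by
  intro s hs
  simp only [nest, Finset.mem_image] at hs
  obtain ⟨t, ht, rfl⟩ := hs
  rw [← List.map_cons, quantifierAlternations_map_dual, List.length_map]
  exact h t ht

lemma QBound.and {φ ψ : GraphFormula m} (h : QBound q j ρ φ) (h' : QBound q j ρ ψ) :
    QBound q j ρ (.and φ ψ) := by
  intro s hs
  simp only [nest, Finset.mem_union] at hs
  exact hs.elim (h s) (h' s)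

lemma QBound.or {φ ψ : GraphFormula m} (h : QBound q j ρ φ) (h' : QBound q j ρ ψ) :
    QBound q j ρ (.or φ ψ) := by
  intro s hs
  simp only [nest, Finset.mem_union] at hs
  exact hs.elim (h s) (h' s)

lemma QBound.ex {φ : GraphFormula (m + 1)} (h : QBound .ex j ρ φ) :
    QBound .ex j (ρ + 1) φ.ex := by
  intro s hs
  simp only [nest, Finset.mem_image] at hs
  obtain ⟨t, ht, rfl⟩ := hs
  simpa [quantifierAlternations] using h t ht

lemma QBound.all {φ : GraphFormula (m + 1)} (h : QBound .all j ρ φ) :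
    QBound .all j (ρ + 1) φ.all := by
  intro s hs
  simp only [nest, Finset.mem_image] at hs
  obtain ⟨t, ht, rfl⟩ := hs
  simpa [quantifierAlternations] using h t ht

lemma QBound.alternationNumber_le {φ : GraphFormula m} (h : QBound q j ρ φ) :
    φ.alternationNumber ≤ j :=
  Finset.sup_le fun s hs ↦ (quantifierAlternations_le_cons q s).trans (h s hs).1

lemma QBound.quantifierRank_le {φ : GraphFormula m} (h : QBound q j ρ φ) :
    φ.quantifierRank ≤ ρ :=
  Finset.sup_le fun s hs ↦ (h s hs).2

/-- The conjunction of a list of formulas. The empty conjunction is `∀ x, x = x`, since a formula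
without free variables needs a quantifier. -/
def conj (l : List (GraphFormula m)) : GraphFormula m :=
  l.foldr .and (.all (.equal (Fin.last m) (Fin.last m)))

/-- The disjunction of a formula with those of a list. -/
def disj (φ : GraphFormula m) (l : List (GraphFormula m)) : GraphFormula m :=
  l.foldr .or φ

lemma realize_conj {V : Type*} {G : SimpleGraph V} {l : List (GraphFormula m)} {y : Fin m → V} :
    (conj l).Realize G y ↔ ∀ φ ∈ l, φ.Realize G y := by
  induction l with
  | nil => simp [conj, Realize]
  | cons φ l ih =>
    rw [List.forall_mem_cons, ← ih]
    rfl

lemma realize_disj {V : Type*} {G : SimpleGraph V} {φ : GraphFormula m}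
    {l : List (GraphFormula m)} {y : Fin m → V} :
    (disj φ l).Realize G y ↔ φ.Realize G y ∨ ∃ ψ ∈ l, ψ.Realize G y := by
  induction l with
  | nil => simp [disj]
  | cons ψ l ih =>
    have : (disj φ (ψ :: l)).Realize G y ↔ ψ.Realize G y ∨ (disj φ l).Realize G y := Iff.rfl
    rw [this, ih]
    simp only [List.exists_mem_cons_iff]
    tauto

lemma QBound.conj {l : List (GraphFormula m)} (h : ∀ φ ∈ l, QBound .ex (j + 1) (ρ + 1) φ) :
    QBound .ex (j + 1) (ρ + 1) (conj l) := by
  induction l with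
  | nil => exact ((QBound.equal _ _).all.switch .ex)
  | cons φ l ih =>
    rw [List.forall_mem_cons] at h
    exact h.1.and (ih h.2)

lemma QBound.disj {φ : GraphFormula m} {l : List (GraphFormula m)} (hφ : QBound q j ρ φ)
    (h : ∀ ψ ∈ l, QBound q j ρ ψ) : QBound q j ρ (disj φ l) := by
  induction l with
  | nil => exact hφ
  | cons ψ l ih =>
    rw [List.forall_mem_cons] at h
    exact h.1.or (ih h.2)

end GraphFormula

/-! ### Distances in vertex-deleted graphs -/

/-- The graph obtained from `G` by removing all edges at the vertices in `T`. -/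
def SimpleGraph.isolate {V : Type*} (G : SimpleGraph V) (T : Set V) : SimpleGraph V where
  Adj a b := G.Adj a b ∧ a ∉ T ∧ b ∉ T
  symm := ⟨fun _ _ h ↦ ⟨h.1.symm, h.2.2, h.2.1⟩⟩
  loopless := ⟨fun _ h ↦ h.1.ne rfl⟩

/-- The vertices `a` and `b` are at distance at most `2 ^ k`, in a form obtained by repeated
bisection of a walk. -/
def SimpleGraph.Near {V : Type*} (G : SimpleGraph V) : ℕ → V → V → Prop
  | 0, a, b => a = b ∨ G.Adj a b
  | k + 1, a, b => ∃ c, G.Near k a c ∧ G.Near k c b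

namespace SimpleGraph

variable {V : Type*} {G : SimpleGraph V}

lemma isolate_mono {S T : Set V} (h : S ⊆ T) : G.isolate T ≤ G.isolate S :=
  fun _ _ hab ↦ ⟨hab.1, fun ha ↦ hab.2.1 (h ha), fun hb ↦ hab.2.2 (h hb)⟩

lemma near_iff_exists_walk {k : ℕ} {a b : V} :
    G.Near k a b ↔ ∃ p : G.Walk a b, p.length ≤ 2 ^ k := by
  induction k generalizing a b with
  | zero =>
    constructor
    · rintro (rfl | h)
      · exact ⟨.nil, by simp⟩
      · exact ⟨h.toWalk, by simp⟩
    · rintro ⟨p, hp⟩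
      cases p with
      | nil => exact Or.inl rfl
      | cons h p =>
        cases p with
        | nil => exact Or.inr h
        | cons h' p => simp at hp
  | succ k ih =>
    constructor
    · rintro ⟨c, h1, h2⟩
      obtain ⟨p, hp⟩ := ih.1 h1
      obtain ⟨q, hq⟩ := ih.1 h2
      exact ⟨p.append q, by rw [Walk.length_append]; omega⟩
    · rintro ⟨p, hp⟩
      refine ⟨p.getVert (2 ^ k), ih.2 ⟨p.take (2 ^ k), ?_⟩, ih.2 ⟨p.drop (2 ^ k), ?_⟩⟩
      · simp
      · simp; omega

lemma Near.reachable {k : ℕ} {a b : V} (h : G.Near k a b) : G.Reachable a b :=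
  let ⟨p, _⟩ := near_iff_exists_walk.1 h
  ⟨p⟩

lemma Reachable.exists_walk_length_lt [Fintype V] {a b : V} (h : G.Reachable a b) :
    ∃ p : G.Walk a b, p.length < Fintype.card V := by
  classical
  obtain ⟨p⟩ := h
  exact ⟨p.toPath, p.toPath.2.length_lt⟩

end SimpleGraph

namespace GraphFormula

/-- The existential formula stating that `x i` and `x i'` are at distance at most `2 ^ k` in
the graph with the vertices `x t`, `t ∈ T`, isolated. -/
def near : (k : ℕ) → {m : ℕ} → List (Fin m) → Fin m → Fin m → GraphFormula m
  | 0, _, T, i, i' => .or (.equal i i')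
      (T.foldr (fun t φ ↦ .and (.and (.neg (.equal i t)) (.neg (.equal i' t))) φ) (.adj i i'))
  | k + 1, m, T, i, i' => .ex (.and
      (near k (T.map Fin.castSucc) i.castSucc (Fin.last m))
      (near k (T.map Fin.castSucc) (Fin.last m) i'.castSucc))

lemma QBound.near {j ρ : ℕ} (k : ℕ) {m : ℕ} (T : List (Fin m)) (i i' : Fin m) (hk : k ≤ ρ) :
    QBound .ex j ρ (near k T i i') := by
  induction k generalizing m ρ with
  | zero =>
    refine (QBound.equal _ _).or ?_
    induction T with
    | nil => exact QBound.adj _ _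
    | cons t T ih =>
      have h : ∀ a b : Fin m, QBound .ex j ρ (.neg (.equal a b)) := fun a b ↦
        (QBound.equal (q := .all) a b).neg
      exact ((h _ _).and (h _ _)).and ih
  | succ k ih =>
    obtain ⟨ρ, rfl⟩ : ∃ ρ', ρ = ρ' + 1 := ⟨ρ - 1, by omega⟩
    exact ((ih _ _ _ (by omega)).and (ih _ _ _ (by omega))).ex

lemma realize_near {V : Type*} {G : SimpleGraph V} {k m : ℕ} {T : List (Fin m)} {i i' : Fin m}
    {y : Fin m → V} :
    (near k T i i').Realize G y ↔ (G.isolate {v | ∃ t ∈ T, y t = v}).Near k (y i) (y i') := by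
  induction k generalizing m with
  | zero =>
    refine or_congr Iff.rfl ?_
    induction T with
    | nil => simp [SimpleGraph.isolate, Realize]
    | cons t T ih =>
      simp only [List.foldr_cons, Realize, ih, SimpleGraph.isolate, Set.mem_ofPred_eq,
        List.exists_mem_cons_iff, eq_comm (a := y t), not_or]
      tauto
  | succ k ih => simp [near, Realize, ih, SimpleGraph.Near]

end GraphFormula

open GraphFormula

/-! ### Defining the pieces of a graph -/

/-- On the set `S`, the map `f` is an isomorphism onto an induced subgraph of `G'`. -/
def IsEmbOn {V V' : Type*} (G : SimpleGraph V) (G' : SimpleGraph V') (f : V → V') (S : Set V) :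
    Prop :=
  ∀ a ∈ S, ∀ b ∈ S, (f a = f b → a = b) ∧ (G'.Adj (f a) (f b) ↔ G.Adj a b)

/-- The set `A` is a union of components of `G` minus `T`, and the set `R ⊆ A` meets each of these
components. -/
structure IsPiece {V : Type*} (G : SimpleGraph V) (A T R : Set V) : Prop where
  subset : R ⊆ A
  disjoint : Disjoint A T
  mem_or_mem : ∀ a ∈ A, ∀ b, G.Adj a b → b ∈ A ∨ b ∈ T
  reachable : ∀ a ∈ A, ∃ r ∈ R, (G.isolate Aᶜ).Reachable r a

namespace IsPiece

variable {V : Type*} {G : SimpleGraph V} {A T R : Set V}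

lemma mem_of_reachable (h : IsPiece G A T R) {U : Set V} (hU : T ⊆ U) {a b : V}
    (hab : (G.isolate U).Reachable a b) (ha : a ∈ A) : b ∈ A := by
  obtain ⟨p⟩ := hab
  induction p with
  | nil => exact ha
  | cons e p ih =>
    exact ih ((h.mem_or_mem _ ha _ e.1).resolve_right fun h' ↦ e.2.2 (hU h'))

/-- A piece is mapped by an embedding `f` to a set that lies in the components of the
representatives after the removal of `f '' U`. -/
lemma exists_walk_image [Fintype V] (h : IsPiece G A T R) {V' : Type*} {G' : SimpleGraph V'}
    {f : V → V'} {U : Set V} (hf : IsEmbOn G G' f (U ∪ A)) (hU : Disjoint A U) {a : V}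
    (ha : a ∈ A) : ∃ r ∈ R, ∃ p : (G'.isolate (f '' U)).Walk (f r) (f a),
      p.length < Fintype.card V := by
  obtain ⟨r, hr, hra⟩ := h.reachable a ha
  obtain ⟨p, hp⟩ := hra.exists_walk_length_lt
  have hnot : ∀ c ∈ A, f c ∉ f '' U := by
    rintro c hc ⟨d, hd, hdc⟩
    have := (hf d (Or.inl hd) c (Or.inr hc)).1 hdc
    exact Set.disjoint_left.1 hU hc (this ▸ hd)
  let φ : G.isolate Aᶜ →g G'.isolate (f '' U) :=
    ⟨f, fun {c d} hcd ↦ by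
      have hc : c ∈ A := not_not.1 hcd.2.1
      have hd : d ∈ A := not_not.1 hcd.2.2
      exact ⟨(hf c (Or.inr hc) d (Or.inr hd)).2.2 hcd.1, hnot c hc, hnot d hd⟩⟩
  exact ⟨r, hr, p.map φ, by rwa [SimpleGraph.Walk.length_map]⟩

end IsPiece

/-- The indices of the vertices of `T` in the list of vertices `x`. -/
noncomputable def indices {V : Type*} {m : ℕ} (x : Fin m → V) (T : Set V) : List (Fin m) :=
  open Classical in (List.finRange m).filter fun i ↦ x i ∈ T

@[simp]
lemma mem_indices {V : Type*} {m : ℕ} {x : Fin m → V} {T : Set V} {i : Fin m} :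
    i ∈ indices x T ↔ x i ∈ T := by
  simp [indices]

lemma setOf_exists_mem_indices {V V' : Type*} {m : ℕ} {x : Fin m → V} {T : Set V}
    (h : T ⊆ Set.range x) (g : V → V') : {v | ∃ t ∈ indices x T, (g ∘ x) t = v} = g '' T := by
  ext v
  constructor
  · rintro ⟨t, ht, rfl⟩
    exact ⟨x t, mem_indices.1 ht, rfl⟩
  · rintro ⟨a, ha, rfl⟩
    obtain ⟨t, rfl⟩ := h ha
    exact ⟨t, mem_indices.2 ha, rfl⟩

/-- There is a formula with quantifier rank at most `ρ` and shape `∃*∀*∃*`, true in `G` under the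
assignment `x`, such that in every graph `G'` where it holds under an assignment that embeds
the vertices in `x`, this embedding extends to the piece `A`, and the image of `A` contains each
vertex at distance at most `2 ^ k` from an image of a representative after the removal of
the image of `T`. -/
def PieceDefinable {V : Type u} (G : SimpleGraph V) (k ρ : ℕ) {m : ℕ} (x : Fin m → V)
    (A T R : Set V) : Prop :=
  ∃ ψ : GraphFormula m, QBound .ex 2 ρ ψ ∧ ψ.Realize G x ∧
    ∀ (V' : Type w) (G' : SimpleGraph V') (g : V → V'), IsEmbOn G G' g (Set.range x) →
      ψ.Realize G' (g ∘ x) → ∃ f : V → V', Set.EqOn f g (Set.range x) ∧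
        IsEmbOn G G' f (Set.range x ∪ A) ∧
        ∀ r ∈ R, ∀ z, (G'.isolate (g '' T)).Near k (g r) z → z ∈ f '' A

/-- A conjunction of atomic formulas and their negations describes how a list of vertices
`x` spans its induced subgraph. -/
lemma exists_formula_isEmbOn {V : Type u} (G : SimpleGraph V) {m : ℕ} (x : Fin m → V) :
    ∃ ψ : GraphFormula m, (∀ ρ, QBound .ex 2 (ρ + 1) ψ) ∧ ψ.Realize G x ∧
      ∀ (V' : Type w) (G' : SimpleGraph V') (y : Fin m → V'), ψ.Realize G' y →
        ∀ i j, (y i = y j ↔ x i = x j) ∧ (G'.Adj (y i) (y j) ↔ G.Adj (x i) (x j)) := by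
  classical
  let eqF : Fin m × Fin m → GraphFormula m := fun p ↦
    if x p.1 = x p.2 then .equal p.1 p.2 else .neg (.equal p.1 p.2)
  let adjF : Fin m × Fin m → GraphFormula m := fun p ↦
    if G.Adj (x p.1) (x p.2) then .adj p.1 p.2 else .neg (.adj p.1 p.2)
  let l := (Finset.univ : Finset (Fin m × Fin m)).toList
  refine ⟨conj (l.map fun p ↦ .and (eqF p) (adjF p)), fun ρ ↦ QBound.conj ?_, ?_, ?_⟩
  · intro φ hφ
    obtain ⟨p, -, rfl⟩ := List.mem_map.1 hφ
    refine QBound.and ?_ ?_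
    · simp only [eqF]; split_ifs
      · exact QBound.equal _ _
      · exact (QBound.equal (q := .all) _ _).neg
    · simp only [adjF]; split_ifs
      · exact QBound.adj _ _
      · exact (QBound.adj (q := .all) _ _).neg
  · rw [realize_conj]
    intro φ hφ
    obtain ⟨p, -, rfl⟩ := List.mem_map.1 hφ
    refine ⟨?_, ?_⟩
    · simp only [eqF]; split_ifs with h
      · exact h
      · exact h
    · simp only [adjF]; split_ifs with h
      · exact h
      · exact h
  · intro V' G' y hy i j
    rw [realize_conj] at hy
    obtain ⟨h1, h2⟩ := hy _ (List.mem_map.2 ⟨(i, j), by simp [l], rfl⟩)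
    constructor
    · by_cases h : x i = x j
      · simp only [eqF, h, if_true] at h1
        exact iff_of_true h1 h
      · simp only [eqF, h, if_false] at h1
        exact iff_of_false h1 h
    · by_cases h : G.Adj (x i) (x j)
      · simp only [adjF, h, if_true] at h2
        exact iff_of_true h2 h
      · simp only [adjF, h, if_false] at h2
        exact iff_of_false h2 h

section

variable {V : Type*} {m : ℕ} {x : Fin m → V} {k : ℕ} {W : Type*} {H : SimpleGraph W} {g : V → W}

lemma realize_near_indices {T : Set V} (hT : T ⊆ Set.range x) {a b : Fin m} :
    (near k (indices x T) a b).Realize H (g ∘ x) ↔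
      (H.isolate (g '' T)).Near k (g (x a)) (g (x b)) := by
  rw [realize_near, setOf_exists_mem_indices hT]
  rfl

lemma realize_near_indices_last {T : Set V} (hT : T ⊆ Set.range x) {a : Fin m} {z : W} :
    (near k ((indices x T).map Fin.castSucc) a.castSucc (Fin.last m)).Realize H
      (Fin.snoc (g ∘ x) z) ↔ (H.isolate (g '' T)).Near k (g (x a)) z := by
  rw [realize_near, ← setOf_exists_mem_indices hT g]
  simp

/-- The formula stating that vertices in `x` which are at distance greater than `2 ^ k` after the
removal of `U` in `G` are so in a given graph. -/
noncomputable def farFormula (G : SimpleGraph V) (k : ℕ) (x : Fin m → V) (U : Set V) :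
    GraphFormula m :=
  open Classical in
  conj (((Finset.univ.filter fun p : Fin m × Fin m ↦
    ¬ (G.isolate U).Near k (x p.1) (x p.2)).toList).map
      fun p ↦ .neg (near k (indices x U) p.1 p.2))

lemma QBound.farFormula (G : SimpleGraph V) {U : Set V} {ρ : ℕ} (hρ : k ≤ ρ + 1) :
    QBound .ex 2 (ρ + 1) (farFormula G k x U) := by
  refine QBound.conj fun φ hφ ↦ ?_
  obtain ⟨p, -, rfl⟩ := List.mem_map.1 hφ
  exact ((QBound.near (j := 0) k (indices x U) p.1 p.2 hρ).neg.switch .ex).mono one_le_two le_rfl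

lemma realize_farFormula {G : SimpleGraph V} {U : Set V} (hU : U ⊆ Set.range x) :
    (farFormula G k x U).Realize H (g ∘ x) ↔ ∀ a b, ¬ (G.isolate U).Near k (x a) (x b) →
      ¬ (H.isolate (g '' U)).Near k (g (x a)) (g (x b)) := by
  simp only [farFormula, realize_conj, List.forall_mem_map, Finset.mem_toList, Finset.mem_filter,
    Finset.mem_univ, true_and, Prod.forall, Realize, realize_near_indices hU]

/-- The formula stating that each vertex `z` near to a vertex of `R` outside `T` is a vertex of `W`
or near to a vertex of some `R' i` outside `T' i`. -/
noncomputable def coverFormula {ι : Type*} [Fintype ι] (k : ℕ) (x : Fin m → V) (T R W : Set V)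
    (T' R' : ι → Set V) : GraphFormula m :=
  conj ((indices x R).map fun a ↦ .all (disj
    (.neg (near k ((indices x T).map Fin.castSucc) a.castSucc (Fin.last m)))
    ((indices x W).map (fun b ↦ .equal (Fin.last m) b.castSucc) ++
      (Finset.univ : Finset ι).toList.flatMap fun i ↦ (indices x (R' i)).map fun b ↦
        near k ((indices x (T' i)).map Fin.castSucc) b.castSucc (Fin.last m))))

lemma QBound.coverFormula {ι : Type*} [Fintype ι] {T R W : Set V} {T' R' : ι → Set V} {ρ : ℕ}
    (hρ : k ≤ ρ) : QBound .ex 2 (ρ + 1) (coverFormula k x T R W T' R') := by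
  refine QBound.conj fun φ hφ ↦ ?_
  obtain ⟨a, -, rfl⟩ := List.mem_map.1 hφ
  refine (QBound.all (QBound.disj ?_ fun φ hφ ↦ ?_)).switch .ex
  · exact (QBound.near (j := 1) k _ _ _ hρ).neg
  · rcases List.mem_append.1 hφ with hφ | hφ
    · obtain ⟨b, -, rfl⟩ := List.mem_map.1 hφ
      exact QBound.equal _ _
    · obtain ⟨i, -, hφ⟩ := List.mem_flatMap.1 hφ
      obtain ⟨b, -, rfl⟩ := List.mem_map.1 hφ
      exact (QBound.near (j := 0) k _ _ _ hρ).switch .all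

lemma realize_coverFormula {ι : Type*} [Fintype ι] {T R S : Set V} {T' R' : ι → Set V}
    (hT : T ⊆ Set.range x) (hT' : ∀ i, T' i ⊆ Set.range x) :
    (coverFormula k x T R S T' R').Realize H (g ∘ x) ↔
      ∀ a, x a ∈ R → ∀ z, (H.isolate (g '' T)).Near k (g (x a)) z →
        (∃ b, x b ∈ S ∧ z = g (x b)) ∨
          ∃ i b, x b ∈ R' i ∧ (H.isolate (g '' T' i)).Near k (g (x b)) z := by
  simp only [coverFormula, realize_conj, List.forall_mem_map, mem_indices]
  refine forall_congr' fun a ↦ forall_congr' fun ha ↦ forall_congr' fun z ↦ ?_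
  simp only [realize_disj, List.mem_append, List.mem_map, List.mem_flatMap, Finset.mem_toList,
    Finset.mem_univ, true_and, mem_indices, or_and_right, exists_or]
  rw [imp_iff_not_or]
  refine or_congr (not_congr (realize_near_indices_last hT)) (or_congr ?_ ?_)
  · constructor
    · rintro ⟨_, ⟨b, hb, rfl⟩, h⟩
      exact ⟨b, hb, by simpa [Realize] using h⟩
    · rintro ⟨b, hb, h⟩
      exact ⟨_, ⟨b, hb, rfl⟩, by simpa [Realize] using h⟩
  · constructor
    · rintro ⟨_, ⟨i, b, hb, rfl⟩, h⟩
      exact ⟨i, b, hb, (realize_near_indices_last (hT' i)).1 h⟩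
    · rintro ⟨i, b, hb, h⟩
      exact ⟨_, ⟨i, b, hb, rfl⟩, (realize_near_indices_last (hT' i)).2 h⟩

end

namespace PieceDefinable

variable {V : Type u} {G : SimpleGraph V} {k ρ m : ℕ} {x : Fin m → V} {A T R : Set V}

lemma mono (h : PieceDefinable.{u, w} G k ρ x A T R) {ρ' : ℕ} (hρ : ρ ≤ ρ') :
    PieceDefinable.{u, w} G k ρ' x A T R :=
  let ⟨ψ, h1, h2⟩ := h
  ⟨ψ, h1.mono le_rfl hρ, h2⟩

/-- One more quantifier makes a further vertex available. -/
lemma of_snoc {v : V} (hT : T ⊆ Set.range x) (hR : R ⊆ Set.range x) (hρ : 1 ≤ ρ)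
    (h : PieceDefinable.{u, w} G k ρ (Fin.snoc x v : Fin (m + 1) → V) A T R) :
    PieceDefinable.{u, w} G k (ρ + 1) x A T R := by
  classical
  obtain ⟨ρ, rfl⟩ : ∃ ρ', ρ = ρ' + 1 := ⟨ρ - 1, by omega⟩
  obtain ⟨ψ, hb, hG, hψ⟩ := h
  obtain ⟨τ, hτb, hτG, hτ⟩ := exists_formula_isEmbOn.{u, w} G (Fin.snoc x v : Fin (m + 1) → V)
  refine ⟨.ex (.and τ ψ), ((hτb ρ).and hb).ex, ⟨v, hτG, hG⟩, ?_⟩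
  rintro V' G' g hg ⟨a, hτa, hψa⟩
  have hemb := hτ V' G' _ hτa
  have hxg : Function.update g v a ∘ x = g ∘ x := by
    funext i
    by_cases hi : x i = v
    · have := (hemb i.castSucc (Fin.last m)).1
      simp only [Fin.snoc_castSucc, Fin.snoc_last] at this
      simpa [hi] using (this.2 hi).symm.trans (by simp [hi])
    · simp [hi]
  have hsnoc : (Fin.snoc (g ∘ x) a : Fin (m + 1) → V') =
      Function.update g v a ∘ (Fin.snoc x v : Fin (m + 1) → V) := by
    rw [← hxg]
    funext i
    refine Fin.lastCases ?_ (fun i ↦ ?_) i <;> simp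
  have hrange : Set.range x ⊆ Set.range (Fin.snoc x v : Fin (m + 1) → V) := by
    rintro _ ⟨i, rfl⟩
    exact ⟨i.castSucc, by simp⟩
  have heq : Set.EqOn (Function.update g v a) g (Set.range x) := by
    rintro _ ⟨i, rfl⟩
    exact congrFun hxg i
  rw [hsnoc] at hψa hemb
  obtain ⟨f, hf1, hf2, hf3⟩ := hψ V' G' (Function.update g v a) (by
    rintro _ ⟨i, rfl⟩ _ ⟨j, rfl⟩
    exact ⟨(hemb i j).1.1, (hemb i j).2⟩) hψa
  refine ⟨f, (hf1.mono hrange).trans heq, fun a ha b hb ↦ hf2 a ?_ b ?_, fun r hr z hz ↦ ?_⟩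
  · exact ha.imp_left fun h ↦ hrange h
  · exact hb.imp_left fun h ↦ hrange h
  · refine hf3 r hr z ?_
    rwa [(heq.mono hT).image_eq, heq (hR hr)]

/-- A piece `A` that is cut by a set `U` into definable smaller pieces is definable. The formula
states that the smaller pieces are as they should be, that they are not joined to each
other outside `U`, and that each vertex `z` which belongs to the piece is in `U` or
in one of the smaller pieces. -/
lemma of_cut [Fintype V] {ι : Type*} [Fintype ι] {U : Set V} {A' T' R' : ι → Set V}
    (hP : IsPiece G A T R) (hP' : ∀ i, IsPiece G (A' i) (T' i) (R' i))
    (hT : T ⊆ Set.range x) (hU : U ⊆ Set.range x) (hR' : ∀ i, R' i ⊆ Set.range x)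
    (hR : R ⊆ Set.range x)
    (hTU : ∀ i, T' i ⊆ U) (hAU : ∀ i, Disjoint (A' i) U)
    (hd : ∀ i j, i ≠ j → Disjoint (A' i) (A' j)) (hsub : ∀ i, A' i ⊆ A)
    (hcov : A ⊆ U ∪ ⋃ i, A' i) (hk : 2 * Fintype.card V ≤ 2 ^ k) (hρ : k + 1 ≤ ρ)
    (hdef : ∀ i, PieceDefinable.{u, w} G k ρ x (A' i) (T' i) (R' i)) :
    PieceDefinable.{u, w} G k ρ x A T R := by
  classical
  obtain ⟨ρ, rfl⟩ : ∃ ρ', ρ = ρ' + 1 := ⟨ρ - 1, by omega⟩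
  choose ψ hψb hψG hψ using hdef
  have hT' : ∀ i, T' i ⊆ Set.range x := fun i ↦ (hTU i).trans hU
  let l : List (GraphFormula m) := (Finset.univ : Finset ι).toList.map ψ
  refine ⟨conj (farFormula G k x U :: coverFormula k x T R (U ∩ A) T' R' :: l),
    QBound.conj ?_, ?_, fun V' G' g hg hreal ↦ ?_⟩
  · simp only [List.forall_mem_cons]
    refine ⟨QBound.farFormula G (by omega), QBound.coverFormula (by omega), fun φ hφ ↦ ?_⟩
    obtain ⟨i, -, rfl⟩ := List.mem_map.1 hφ
    exact hψb i
  · rw [realize_conj]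
    simp only [List.forall_mem_cons]
    refine ⟨?_, ?_, fun φ hφ ↦ ?_⟩
    · refine (realize_farFormula (g := id) hU).2 fun a b h ↦ ?_
      simpa using h
    · refine (realize_coverFormula (g := id) hT hT').2 fun a ha z hz ↦ ?_
      rw [Set.image_id] at hz
      have hzA : z ∈ A := hP.mem_of_reachable le_rfl hz.reachable (hP.subset ha)
      rcases hcov hzA with hzU | hzA'
      · obtain ⟨b, rfl⟩ := hU hzU
        exact Or.inl ⟨b, ⟨hzU, hzA⟩, rfl⟩
      · obtain ⟨i, hi⟩ := Set.mem_iUnion.1 hzA'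
        obtain ⟨r, hr, hrz⟩ := (hP' i).reachable z hi
        obtain ⟨b, rfl⟩ := hR' i hr
        have hle : G.isolate (A' i)ᶜ ≤ G.isolate (T' i) :=
          SimpleGraph.isolate_mono (Set.disjoint_left.1 (hP' i).disjoint.symm)
        obtain ⟨p, hp⟩ := (hrz.mono hle).exists_walk_length_lt
        refine Or.inr ⟨i, b, hr, ?_⟩
        rw [Set.image_id]
        exact SimpleGraph.near_iff_exists_walk.2 ⟨p, by omega⟩
    · obtain ⟨i, -, rfl⟩ := List.mem_map.1 hφ
      exact hψG i
  rw [realize_conj] at hreal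
  simp only [List.forall_mem_cons] at hreal
  obtain ⟨hfar, hcover, hl⟩ := hreal
  rw [realize_farFormula hU] at hfar
  rw [realize_coverFormula hT hT'] at hcover
  have h := fun i ↦ hψ i V' G' g hg (hl _ (List.mem_map.2 ⟨i, by simp, rfl⟩))
  choose f hfg hfe hfn using h
  -- the embeddings of the smaller pieces are glued together
  let F : V → V' := fun v ↦ if h : ∃ i, v ∈ A' i then f h.choose v else g v
  have hFf : ∀ i, ∀ v ∈ A' i, F v = f i v := by
    intro i v hv
    have hex : ∃ i, v ∈ A' i := ⟨i, hv⟩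
    have : hex.choose = i := by
      by_contra hne
      exact Set.disjoint_left.1 (hd _ _ hne) hex.choose_spec hv
    simp only [F, dif_pos hex, this]
  have hFg : ∀ v ∈ Set.range x, F v = g v := by
    intro v hv
    by_cases hex : ∃ i, v ∈ A' i
    · obtain ⟨i, hi⟩ := hex
      rw [hFf i v hi, hfg i hv]
    · simp only [F, dif_neg hex]
  have hFi : ∀ i, ∀ v ∈ Set.range x ∪ A' i, F v = f i v := by
    rintro i v (hv | hv)
    · rw [hFg v hv, hfg i hv]
    · exact hFf i v hv
  -- the images of two different smaller pieces are disjoint, and no edge joins them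
  have hsep : ∀ i j, i ≠ j → ∀ a ∈ A' i, ∀ b ∈ A' j, F a ≠ F b ∧ ¬ G'.Adj (F a) (F b) := by
    intro i j hij a ha b hb
    have hemb : ∀ i, IsEmbOn G G' (f i) (U ∪ A' i) := fun i c hc d hd ↦
      hfe i c (hc.imp_left fun h ↦ hU h) d (hd.imp_left fun h ↦ hU h)
    have hwalk : ∀ i, ∀ c ∈ A' i, ∃ r ∈ R' i, ∃ p : (G'.isolate (g '' U)).Walk (g r) (F c),
        p.length < Fintype.card V := by
      intro i c hc
      have h := (hP' i).exists_walk_image (hemb i) (hAU i) hc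
      rw [((hfg i).mono hU).image_eq, ← hFf i c hc] at h
      obtain ⟨r, hr, p, hp⟩ := h
      exact ⟨r, hr, p.copy (hfg i (hR' i hr)) rfl, by rwa [SimpleGraph.Walk.length_copy]⟩
    obtain ⟨r, hr, p, hp⟩ := hwalk i a ha
    obtain ⟨r', hr', q, hq⟩ := hwalk j b hb
    have hnot : ∀ i, ∀ c ∈ A' i, F c ∉ g '' U := by
      rintro i c hc ⟨d, hd, hdc⟩
      rw [hFf i c hc, ← hfg i (hU hd)] at hdc
      exact Set.disjoint_left.1 (hAU i) hc ((hemb i d (Or.inl hd) c (Or.inr hc)).1 hdc ▸ hd)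
    have hno : ∀ s : (G'.isolate (g '' U)).Walk (F a) (F b), ¬ s.length ≤ 1 := by
      intro s hs
      obtain ⟨c, rfl⟩ := hR' i hr
      obtain ⟨d, rfl⟩ := hR' j hr'
      refine hfar c d (fun hnear ↦ ?_) (SimpleGraph.near_iff_exists_walk.2
        ⟨p.append (s.append q.reverse), ?_⟩)
      · exact Set.disjoint_left.1 (hd i j hij)
          ((hP' i).mem_of_reachable (hTU i) hnear.reachable ((hP' i).subset hr))
          ((hP' j).subset hr')
      · simp only [SimpleGraph.Walk.length_append, SimpleGraph.Walk.length_reverse]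
        omega
    constructor
    · intro h
      exact hno (SimpleGraph.Walk.nil.copy rfl h) (by simp)
    · intro h
      have h' : (G'.isolate (g '' U)).Adj (F a) (F b) := ⟨h, hnot i a ha, hnot j b hb⟩
      exact hno h'.toWalk (by simp)
  refine ⟨F, hFg, ?_, ?_⟩
  · have hmem : ∀ a ∈ Set.range x ∪ A, a ∈ Set.range x ∨ ∃ i, a ∈ A' i := by
      rintro a (ha | ha)
      · exact Or.inl ha
      · exact (hcov ha).imp (fun h ↦ hU h) fun h ↦ Set.mem_iUnion.1 h
    have hin : ∀ i, IsEmbOn G G' F (Set.range x ∪ A' i) := by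
      intro i a ha b hb
      rw [hFi i a ha, hFi i b hb]
      exact hfe i a ha b hb
    intro a ha b hb
    rcases hmem a ha with hax | ⟨i, hai⟩
    · rcases hmem b hb with hbx | ⟨j, hbj⟩
      · rw [hFg a hax, hFg b hbx]
        exact hg a hax b hbx
      · exact hin j a (Or.inl hax) b (Or.inr hbj)
    · rcases hmem b hb with hbx | ⟨j, hbj⟩
      · exact hin i a (Or.inr hai) b (Or.inl hbx)
      · by_cases hij : i = j
        · subst hij
          exact hin i a (Or.inr hai) b (Or.inr hbj)
        · obtain ⟨h1, h2⟩ := hsep i j hij a hai b hbj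
          refine ⟨fun h ↦ absurd h h1, iff_of_false h2 fun h ↦ ?_⟩
          rcases (hP' i).mem_or_mem a hai b h with h | h
          · exact Set.disjoint_left.1 (hd i j hij) h hbj
          · exact Set.disjoint_left.1 (hAU j) hbj (hTU i h)
  · intro r hr z hz
    obtain ⟨a, rfl⟩ := hR hr
    rcases hcover a hr z hz with ⟨b, hb, rfl⟩ | ⟨i, b, hb, hz⟩
    · exact ⟨x b, hb.2, hFg _ ⟨b, rfl⟩⟩
    · obtain ⟨v, hv, rfl⟩ := hfn i _ hb z hz
      exact ⟨v, hsub i hv, hFf i v hv⟩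

end PieceDefinable

lemma snoc_elim0 {W : Type*} (a : W) :
    (Fin.snoc (α := fun _ : Fin 1 ↦ W) Fin.elim0 a) = fun _ ↦ a := by
  funext i
  refine Fin.lastCases ?_ (fun j ↦ j.elim0) i
  rw [Fin.snoc_last]

/-- If the whole graph is a definable piece, then the graph is definable. -/
theorem exists_defines_of_pieceDefinable {V : Type u} [Fintype V] {G : SimpleGraph V} {k ρ : ℕ}
    {r : V} (hP : IsPiece G Set.univ ∅ {r}) (hk : 2 * Fintype.card V ≤ 2 ^ k) (hρ : k + 1 ≤ ρ)
    (h : PieceDefinable.{u, w} G k ρ (fun _ : Fin 1 ↦ r) Set.univ ∅ {r}) :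
    ∃ Φ : GraphFormula 0, Defines.{u, w} Φ G ∧ QBound .ex 2 (ρ + 1) Φ := by
  obtain ⟨ρ, rfl⟩ : ∃ ρ', ρ = ρ' + 1 := ⟨ρ - 1, by omega⟩
  obtain ⟨ψ, hψb, hψG, hψ⟩ := h
  refine ⟨.ex (.and ψ (.all (near k [] (0 : Fin 1).castSucc (Fin.last 1)))), ⟨?_, ?_⟩, ?_⟩
  · refine ⟨r, ?_, fun z ↦ ?_⟩
    · rwa [snoc_elim0]
    · rw [realize_near]
      obtain ⟨r', hr', hrz⟩ := hP.reachable z trivial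
      obtain rfl := hr'
      rw [Set.compl_univ] at hrz
      obtain ⟨p, hp⟩ := hrz.exists_walk_length_lt
      have : (G.isolate ∅).Near k r' z :=
        SimpleGraph.near_iff_exists_walk.2 ⟨p, by omega⟩
      simpa [Fin.snoc] using this
  · rintro V' G' hne ⟨a, hψa, hall⟩
    refine hne ?_
    obtain ⟨f, -, hf, hsurj⟩ := hψ V' G' (fun _ ↦ a)
      (by rintro _ ⟨-, rfl⟩ _ ⟨-, rfl⟩; simp) (by
        rwa [snoc_elim0] at hψa)
    have hz : ∀ z, ∃ v, f v = z := by
      intro z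
      have := hall z
      rw [realize_near] at this
      obtain ⟨v, -, hv⟩ := hsurj r rfl z (by simpa [Fin.snoc] using this)
      exact ⟨v, hv⟩
    have hfi : ∀ u v, (f u = f v → u = v) ∧ (G'.Adj (f u) (f v) ↔ G.Adj u v) := fun u v ↦
      hf u (Or.inr trivial) v (Or.inr trivial)
    exact ⟨⟨Equiv.ofBijective f ⟨fun u v h ↦ (hfi u v).1 h, hz⟩, fun {u v} ↦ (hfi u v).2⟩⟩
  · refine (hψb.and ?_).ex
    exact ((QBound.near (j := 0) k _ _ _ (by omega)).switch .all).all.switch .ex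

/-- The piece `A` is definable from any list of vertices that contains the set `X`. -/
def PieceDefinableFrom {V : Type u} (G : SimpleGraph V) (k ρ : ℕ) (X A T R : Set V) : Prop :=
  ∀ (m : ℕ) (x : Fin m → V), X ⊆ Set.range x → PieceDefinable.{u, w} G k ρ x A T R

namespace PieceDefinableFrom

variable {V : Type u} {G : SimpleGraph V} {k ρ : ℕ} {X A T R : Set V}

lemma mono (h : PieceDefinableFrom.{u, w} G k ρ X A T R) {ρ' : ℕ} (hρ : ρ ≤ ρ') {X' : Set V}
    (hX : X ⊆ X') : PieceDefinableFrom.{u, w} G k ρ' X' A T R :=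
  fun m x hx ↦ (h m x (hX.trans hx)).mono hρ

lemma of_insert {v : V} (hT : T ⊆ X) (hR : R ⊆ X) (hρ : 1 ≤ ρ)
    (h : PieceDefinableFrom.{u, w} G k ρ (insert v X) A T R) :
    PieceDefinableFrom.{u, w} G k (ρ + 1) X A T R := by
  refine fun m x hx ↦ .of_snoc (v := v) (hT.trans hx) (hR.trans hx) hρ (h _ _ ?_)
  rintro a (rfl | ha)
  · exact ⟨Fin.last m, by simp⟩
  · obtain ⟨i, rfl⟩ := hx ha
    exact ⟨i.castSucc, by simp⟩

end PieceDefinableFrom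

/-! ### Pieces of an outerplanar graph with a Hamilton cycle -/

/-- No edge joins a vertex with a number between `a` and `b` to a vertex with a number outside the
interval `[a, b]`. -/
def Uncrossed {V : Type*} (G : SimpleGraph V) (ℓ : V → ℕ) (a b : ℕ) : Prop :=
  ∀ u v, G.Adj u v → a < ℓ u → ℓ u < b → a ≤ ℓ v ∧ ℓ v ≤ b

/-- The part of a polygon between two nested uncrossed pairs `(a, b)` and `(x, y)`, where
`a ≤ x ≤ y ≤ b`. The strip `⟨a, a, a, b⟩` stands for the part cut off by one pair `(a, b)`. -/
structure Strip where
  a : ℕ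
  x : ℕ
  y : ℕ
  b : ℕ

namespace Strip

/-- The numbers of the vertices inside a strip. -/
def inner (s : Strip) : Set ℕ := Set.Ioo s.a s.x ∪ Set.Ioo s.y s.b

/-- The numbers that separate a strip from the rest of the polygon. -/
def ends (s : Strip) : Set ℕ := {s.a, s.x, s.y, s.b}

/-- The numbers that start the two arcs of a strip. -/
def starts (s : Strip) : Set ℕ := {s.a + 1, s.y + 1}

/-- The total length of the two arcs of a strip. -/
def width (s : Strip) : ℕ := (s.x - s.a) + (s.b - s.y)

/-- The strip lies in the polygon with the vertices `0, …, n - 1`, and both pairs are uncrossed. The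
number `n` itself may be used as an end: then the strip has no end there. -/
structure IsValid {V : Type*} (G : SimpleGraph V) (n : ℕ) (ℓ : V → ℕ) (s : Strip) : Prop where
  a_le_x : s.a ≤ s.x
  x_le_y : s.x ≤ s.y
  y_le_b : s.y ≤ s.b
  b_le : s.b ≤ n
  outer : Uncrossed G ℓ s.a s.b
  inner : Uncrossed G ℓ s.x s.y

end Strip

section

variable {V : Type u} {G : SimpleGraph V} {n : ℕ} {ℓ : V → ℕ}

lemma uncrossed_self (a : ℕ) : Uncrossed G ℓ a a := fun u v _ h1 h2 ↦ by omega

lemma uncrossed_succ (a : ℕ) : Uncrossed G ℓ a (a + 1) := fun u v _ h1 h2 ↦ by omega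

namespace IsPolygonLabelling

lemma uncrossed_of_adj (hℓ : IsPolygonLabelling G n ℓ) {u v : V} (h : G.Adj u v) :
    Uncrossed G ℓ (ℓ u) (ℓ v) := by
  intro c d hcd h1 h2
  by_contra hcon
  rcases lt_or_ge (ℓ d) (ℓ u) with h3 | h3
  · exact hℓ.not_cross d u c v h3 h1 h2 hcd.symm h
  · exact hℓ.not_cross u c v d h1 h2 (by omega) h hcd

lemma uncrossed_zero (hℓ : IsPolygonLabelling G n ℓ) : Uncrossed G ℓ 0 n :=
  fun _ v _ _ _ ↦ ⟨Nat.zero_le _, (hℓ.lt v).le⟩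

lemma reachable_isolate (hℓ : IsPolygonLabelling G n ℓ) {A : Set V} {u v : V} (huv : ℓ u ≤ ℓ v)
    (hA : ∀ w, ℓ u ≤ ℓ w → ℓ w ≤ ℓ v → w ∈ A) : (G.isolate Aᶜ).Reachable u v := by
  obtain ⟨p, hp⟩ :=
    exists_walk_support_between hℓ.injective hℓ.lt hℓ.exists_eq hℓ.adj_of_eq_succ huv
  refine ⟨p.transfer _ fun e he ↦ ?_⟩
  induction e with
  | h c d =>
    have hc := hp c (p.fst_mem_support_of_mem_edges he)
    have hd := hp d (p.snd_mem_support_of_mem_edges he)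
    exact ⟨p.adj_of_mem_edges he, not_not.2 (hA c hc.1 hc.2), not_not.2 (hA d hd.1 hd.2)⟩

lemma isPiece (hℓ : IsPolygonLabelling G n ℓ) {s : Strip} (hs : s.IsValid G n ℓ) :
    IsPiece G (ℓ ⁻¹' s.inner) (ℓ ⁻¹' s.ends) (ℓ ⁻¹' (s.starts ∩ s.inner)) := by
  obtain ⟨a, x, y, b⟩ := s
  obtain ⟨h1, h2, h3, h4, h5, h6⟩ := hs
  simp only at h1 h2 h3 h4 h5 h6
  refine ⟨fun u hu ↦ hu.2, ?_, ?_, ?_⟩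
  · rw [Set.disjoint_left]
    intro u hu hu'
    simp only [Strip.inner, Strip.ends, Set.mem_preimage, Set.mem_union, Set.mem_Ioo,
      Set.mem_insert_iff, Set.mem_singleton_iff] at hu hu'
    omega
  · intro u hu v huv
    have e1 := h5 u v huv
    have e2 := h6 v u huv.symm
    simp only [Strip.inner, Strip.ends, Set.mem_preimage, Set.mem_union, Set.mem_Ioo,
      Set.mem_insert_iff, Set.mem_singleton_iff] at hu ⊢
    omega
  · intro u hu
    have hun := hℓ.lt u
    rcases hu with hu | hu
    · simp only [Set.mem_Ioo] at hu
      obtain ⟨r, hr⟩ := hℓ.exists_eq (a + 1) (by omega)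
      refine ⟨r, ⟨Or.inl hr, Or.inl ?_⟩, hℓ.reachable_isolate (by omega) fun w hw hw' ↦
        Or.inl ?_⟩ <;> simp only [Set.mem_Ioo] <;> omega
    · simp only [Set.mem_Ioo] at hu
      obtain ⟨r, hr⟩ := hℓ.exists_eq (y + 1) (by omega)
      refine ⟨r, ⟨Or.inr hr, Or.inr ?_⟩, hℓ.reachable_isolate (by omega) fun w hw hw' ↦
        Or.inr ?_⟩ <;> simp only [Set.mem_Ioo] <;> omega

end IsPolygonLabelling

/-- The vertices inside a strip form a piece that is definable from the ends of the strip and the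
starting points of its arcs. -/
def StripDefinable (G : SimpleGraph V) (ℓ : V → ℕ) (k ρ : ℕ) (s : Strip) : Prop :=
  PieceDefinableFrom.{u, w} G k ρ (ℓ ⁻¹' (s.ends ∪ s.starts)) (ℓ ⁻¹' s.inner) (ℓ ⁻¹' s.ends)
    (ℓ ⁻¹' (s.starts ∩ s.inner))

lemma PieceDefinableFrom.of_list (hℓ : Function.Injective ℓ) {k ρ : ℕ} {S : Set ℕ} {A T R : Set V}
    (hT : T ⊆ ℓ ⁻¹' S) (hR : R ⊆ ℓ ⁻¹' S) (hρ : 1 ≤ ρ) (L : List ℕ)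
    (h : PieceDefinableFrom.{u, w} G k ρ (ℓ ⁻¹' (S ∪ {c | c ∈ L})) A T R) :
    PieceDefinableFrom.{u, w} G k (ρ + L.length) (ℓ ⁻¹' S) A T R := by
  induction L generalizing S with
  | nil => exact h.mono le_rfl (by simp)
  | cons c L ih =>
    have h' : PieceDefinableFrom.{u, w} G k (ρ + L.length) (ℓ ⁻¹' (insert c S)) A T R := by
      refine ih (hT.trans ?_) (hR.trans ?_) (h.mono le_rfl ?_)
      · exact Set.preimage_mono (Set.subset_insert _ _)
      · exact Set.preimage_mono (Set.subset_insert _ _)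
      · intro v hv
        simp only [Set.mem_preimage, Set.mem_union, Set.mem_ofPred_eq, List.mem_cons,
          Set.mem_insert_iff] at hv ⊢
        tauto
    rw [List.length_cons, ← add_assoc]
    by_cases hc : ∃ v, ℓ v = c
    · obtain ⟨v, rfl⟩ := hc
      refine .of_insert (v := v) hT hR (by omega) (h'.mono le_rfl ?_)
      rintro u (hu | hu)
      · exact Or.inl (hℓ hu)
      · exact Or.inr hu
    · refine h'.mono (Nat.le_succ _) ?_
      rintro u (hu | hu)
      · exact absurd ⟨u, hu⟩ hc
      · exact hu

namespace StripDefinable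

variable [Fintype V] {k ρ : ℕ}

lemma of_inner_eq_empty (hℓ : IsPolygonLabelling G n ℓ) {s : Strip} (hs : s.IsValid G n ℓ)
    (hk : 2 * Fintype.card V ≤ 2 ^ k) (hρ : k + 1 ≤ ρ) (h : s.inner = ∅) :
    StripDefinable.{u, w} G ℓ k ρ s := by
  intro m x hx
  rw [Set.preimage_union, Set.union_subset_iff] at hx
  have hR : ℓ ⁻¹' (s.starts ∩ s.inner) ⊆ ℓ ⁻¹' s.starts := fun _ h ↦ h.1
  exact .of_cut (ι := Empty) (U := ∅) (A' := fun _ ↦ ∅) (T' := fun _ ↦ ∅) (R' := fun _ ↦ ∅)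
    (hℓ.isPiece hs) (fun i ↦ i.elim) hx.1 (by simp) (fun i ↦ i.elim) (hR.trans hx.2)
    (fun i ↦ i.elim) (fun i ↦ i.elim) (fun i ↦ i.elim) (fun i ↦ i.elim) (by simp [h]) hk hρ
    (fun i ↦ i.elim)

/-- A strip is definable if it can be cut into three definable strips, at the cost of one
quantifier for each new number in the list `L`. -/
lemma of_cut_three (hℓ : IsPolygonLabelling G n ℓ) {s : Strip} (hs : s.IsValid G n ℓ)
    (hk : 2 * Fintype.card V ≤ 2 ^ k) (hρ : k + 1 ≤ ρ) {s' : Fin 3 → Strip} (U : Set ℕ)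
    (L : List ℕ) (hs' : ∀ i, (s' i).IsValid G n ℓ)
    (hdef : ∀ i, StripDefinable.{u, w} G ℓ k ρ (s' i))
    (hends : ∀ i, (s' i).ends ⊆ U) (hU : U ⊆ s.ends ∪ {c | c ∈ L})
    (hstarts : ∀ i, (s' i).starts ⊆ s.starts ∪ {c | c ∈ L})
    (hAU : ∀ i, ∀ c ∈ (s' i).inner, c ∉ U)
    (hd : ∀ i j, i < j → ∀ c ∈ (s' i).inner, c ∉ (s' j).inner)
    (hsub : ∀ i, (s' i).inner ⊆ s.inner)
    (hcov : ∀ c ∈ s.inner, c ∈ U ∨ ∃ i, c ∈ (s' i).inner) :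
    StripDefinable.{u, w} G ℓ k (ρ + L.length) s := by
  have hT : s.ends ⊆ s.ends ∪ s.starts := Set.subset_union_left
  have hR : s.starts ∩ s.inner ⊆ s.ends ∪ s.starts := fun _ h ↦ Or.inr h.1
  refine .of_list hℓ.injective (Set.preimage_mono hT) (Set.preimage_mono hR) (by omega) L
    fun m x hx ↦ ?_
  have hrange : ∀ S : Set ℕ, S ⊆ s.ends ∪ s.starts ∪ {c | c ∈ L} → ℓ ⁻¹' S ⊆ Set.range x :=
    fun S hS ↦ (Set.preimage_mono hS).trans hx
  have hU' : U ⊆ s.ends ∪ s.starts ∪ {c | c ∈ L} :=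
    hU.trans (Set.union_subset_union_left _ hT)
  have hst : ∀ i, (s' i).starts ⊆ s.ends ∪ s.starts ∪ {c | c ∈ L} := fun i ↦
    (hstarts i).trans (Set.union_subset_union_left _ Set.subset_union_right)
  refine .of_cut (U := ℓ ⁻¹' U) (hℓ.isPiece hs) (fun i ↦ hℓ.isPiece (hs' i))
    (hrange _ (hT.trans Set.subset_union_left)) (hrange _ hU')
    (fun i ↦ hrange _ (Set.inter_subset_left.trans (hst i)))
    (hrange _ (hR.trans Set.subset_union_left)) (fun i ↦ Set.preimage_mono (hends i)) ?_ ?_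
    (fun i ↦ Set.preimage_mono (hsub i)) ?_ hk hρ fun i ↦ hdef i m x ?_
  · exact fun i ↦ Set.disjoint_left.2 fun v hv ↦ hAU i _ hv
  · intro i j hij
    rcases lt_or_gt_of_ne hij with h | h
    · exact (Set.disjoint_left.2 (hd i j h)).preimage ℓ
    · exact (Set.disjoint_left.2 (hd j i h)).symm.preimage ℓ
  · intro v hv
    rcases hcov _ hv with h | ⟨i, h⟩
    · exact Or.inl h
    · exact Or.inr (Set.mem_iUnion.2 ⟨i, h⟩)
  · exact hrange _ (Set.union_subset ((hends i).trans hU') (hst i))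

/-- The part cut off by an uncrossed pair `(a, b)` is refined by a minimal uncrossed pair `(p, q)`
with `q - p` more than one half of `b - a`, and by the last `t < q` such that `(p, t)` is uncrossed.
Then `(t, q)` is uncrossed as well, and all three parts have width at most `(b - a) / 2`. -/
lemma of_interval (hℓ : IsPolygonLabelling G n ℓ) (hk : 2 * Fintype.card V ≤ 2 ^ k)
    (hρ : k + 1 ≤ ρ) {W : ℕ}
    (H : ∀ s : Strip, s.IsValid G n ℓ → 2 * s.width ≤ W → StripDefinable.{u, w} G ℓ k ρ s)
    {a b : ℕ} (hs : (Strip.mk a a a b).IsValid G n ℓ) (hW : b - a ≤ W) :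
    StripDefinable.{u, w} G ℓ k (ρ + 6) ⟨a, a, a, b⟩ := by
  classical
  obtain ⟨-, -, hab, hbn, hunc, -⟩ := id hs
  simp only at hab hbn hunc
  rcases lt_or_ge (b - a) 2 with h2 | h2
  · refine of_inner_eq_empty hℓ hs hk (by omega) ?_
    ext c
    simp only [Strip.inner, Set.mem_union, Set.mem_Ioo, Set.mem_empty_iff_false, iff_false]
    omega
  have hex : ∃ d p q, q = p + d ∧ a ≤ p ∧ q ≤ b ∧ Uncrossed G ℓ p q ∧ b - a < 2 * d :=
    ⟨b - a, a, b, by omega, le_rfl, le_rfl, hunc, by omega⟩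
  obtain ⟨p, q, hq, hap, hqb, hpq, hd⟩ := Nat.find_spec hex
  have hmin : ∀ p' q', p ≤ p' → q' ≤ q → q' - p' < q - p → p' ≤ q' → Uncrossed G ℓ p' q' →
      2 * (q' - p') ≤ b - a := by
    intro p' q' h1 h2 h3 h4 h5
    have := Nat.find_min hex (m := q' - p') (by omega)
    by_contra hcon
    exact this ⟨p', q', by omega, by omega, by omega, h5, by omega⟩
  generalize Nat.find hex = d at hq hd
  obtain ⟨e, he⟩ : ∃ e, q = p + 2 + e := ⟨q - p - 2, by omega⟩
  let P : ℕ → Prop := fun t ↦ p < t ∧ Uncrossed G ℓ p t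
  have hP : P (p + 1) := ⟨by omega, uncrossed_succ p⟩
  obtain ⟨hpt, hut⟩ : P (Nat.findGreatest P (q - 1)) :=
    Nat.findGreatest_spec (by omega) hP
  have htq : Nat.findGreatest P (q - 1) ≤ q - 1 := Nat.findGreatest_le _
  have hmax : ∀ t, t ≤ q - 1 → P t → t ≤ Nat.findGreatest P (q - 1) := fun t h1 h2 ↦
    Nat.le_findGreatest h1 h2
  generalize Nat.findGreatest P (q - 1) = t at hpt hut htq hmax
  have htq' : Uncrossed G ℓ t q := by
    intro u v huv h1 h2
    have e1 := hpq u v huv (by omega) h2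
    refine ⟨?_, e1.2⟩
    by_contra hcon
    have e2 := hut v u huv.symm
    obtain hv : ℓ v = p := by omega
    have := hmax (ℓ u) (by omega) ⟨by omega, hv ▸ hℓ.uncrossed_of_adj huv.symm⟩
    omega
  have m1 := hmin p t le_rfl (by omega) (by omega) (by omega) hut
  have m2 := hmin t q (by omega) le_rfl (by omega) (by omega) htq'
  have hs' : ∀ i, (![⟨a, p, q, b⟩, ⟨p, p, p, t⟩, ⟨t, t, t, q⟩] i : Strip).IsValid G n ℓ := by
    intro i
    fin_cases i
    · exact ⟨hap, by simp; omega, hqb, hbn, hunc, hpq⟩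
    · exact ⟨le_rfl, le_rfl, hpt.le, by simp; omega, hut, uncrossed_self p⟩
    · exact ⟨le_rfl, le_rfl, by simp; omega, by simp; omega, htq', uncrossed_self t⟩
  refine of_cut_three hℓ hs hk hρ {a, p, t, q, b} [p, t, q, p + 1, t + 1, q + 1] hs'
    (fun i ↦ H _ (hs' i) ?_) ?_ ?_ ?_ ?_ ?_ ?_ ?_
  · fin_cases i <;> simp [Strip.width] <;> omega
  · intro i c hc
    fin_cases i <;> simp [Strip.ends] at hc ⊢ <;> omega
  · intro c hc
    simp [Strip.ends] at hc ⊢; omega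
  · intro i c hc
    fin_cases i <;> simp [Strip.starts] at hc ⊢ <;> omega
  · intro i c hc
    fin_cases i <;> simp [Strip.inner] at hc ⊢ <;> omega
  · intro i j hij c hc
    fin_cases i <;> fin_cases j <;> simp [Strip.inner] at hij hc ⊢ <;> omega
  · intro i c hc
    fin_cases i <;> simp [Strip.inner] at hc ⊢ <;> omega
  · intro c hc
    simp [Strip.inner, Fin.exists_fin_succ] at hc ⊢
    omega

/-- A strip of width `v` is refined by two nested uncrossed pairs `(p, q)` and `(p', q')`: the first
is minimal with the property that the part of the strip inside it has width more than `v / 2`, and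
the second is a maximal one strictly inside the first. These pairs have a common end. The strip
outside `(p, q)` and the strip inside `(p', q')` have width at most `v / 2`, and the part between the
two pairs is cut off by one uncrossed pair, hence may be as wide as `v`. -/
lemma of_strip (hℓ : IsPolygonLabelling G n ℓ) (hk : 2 * Fintype.card V ≤ 2 ^ k)
    (hρ : k + 1 ≤ ρ) {W : ℕ}
    (H : ∀ s : Strip, s.IsValid G n ℓ → 2 * s.width ≤ W → StripDefinable.{u, w} G ℓ k ρ s)
    (HI : ∀ a b, (Strip.mk a a a b).IsValid G n ℓ → b - a ≤ W →
      StripDefinable.{u, w} G ℓ k ρ ⟨a, a, a, b⟩)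
    {s : Strip} (hs : s.IsValid G n ℓ) (hW : s.width ≤ W) :
    StripDefinable.{u, w} G ℓ k (ρ + 6) s := by
  classical
  obtain ⟨a, x, y, b⟩ := s
  obtain ⟨hax, hxy, hyb, hbn, hunc, hxyu⟩ := id hs
  simp only [Strip.width] at hax hxy hyb hbn hunc hxyu hW
  rcases Nat.eq_zero_or_pos ((x - a) + (b - y)) with h0 | h0
  · refine of_inner_eq_empty hℓ hs hk (by omega) ?_
    ext c
    simp only [Strip.inner, Set.mem_union, Set.mem_Ioo, Set.mem_empty_iff_false, iff_false]
    omega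
  have hex : ∃ d p q, d = (x - p) + (q - y) ∧ a ≤ p ∧ p ≤ x ∧ y ≤ q ∧ q ≤ b ∧
      Uncrossed G ℓ p q ∧ (x - a) + (b - y) < 2 * d :=
    ⟨_, a, b, rfl, le_rfl, hax, hyb, le_rfl, hunc, by omega⟩
  obtain ⟨p, q, hd, hap, hpx, hyq, hqb, hpq, hd2⟩ := Nat.find_spec hex
  have hmin : ∀ p' q', p ≤ p' → p' ≤ x → y ≤ q' → q' ≤ q → (x - p') + (q' - y) < Nat.find hex →
      Uncrossed G ℓ p' q' → 2 * ((x - p') + (q' - y)) ≤ (x - a) + (b - y) := by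
    intro p' q' h1 h2 h3 h4 h5 h6
    by_contra hcon
    exact Nat.find_min hex h5 ⟨p', q', rfl, by omega, h2, h3, by omega, h6, by omega⟩
  generalize Nat.find hex = d at hd hd2 hmin
  let P : ℕ → Prop := fun e ↦ ∃ p' q', e = (x - p') + (q' - y) ∧ p ≤ p' ∧ p' ≤ x ∧ y ≤ q' ∧
    q' ≤ q ∧ Uncrossed G ℓ p' q'
  have hP : P 0 := ⟨x, y, by omega, hpx, le_rfl, le_rfl, hyq, hxyu⟩
  obtain ⟨p', q', he, hpp', hp'x, hyq', hq'q, hpq'⟩ : P (Nat.findGreatest P (d - 1)) :=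
    Nat.findGreatest_spec (Nat.zero_le _) hP
  have hlt : Nat.findGreatest P (d - 1) ≤ d - 1 := Nat.findGreatest_le _
  have hmax : ∀ p₁ q₁, p ≤ p₁ → p₁ ≤ x → y ≤ q₁ → q₁ ≤ q → Uncrossed G ℓ p₁ q₁ →
      (x - p₁) + (q₁ - y) ≤ d - 1 → (x - p₁) + (q₁ - y) ≤ Nat.findGreatest P (d - 1) :=
    fun p₁ q₁ h1 h2 h3 h4 h5 h6 ↦ Nat.le_findGreatest h6 ⟨p₁, q₁, rfl, h1, h2, h3, h4, h5⟩
  generalize Nat.findGreatest P (d - 1) = e at he hlt hmax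
  have m1 := hmin p' q' hpp' hp'x hyq' hq'q (by omega) hpq'
  -- an edge from `[p, p']` to `[q', q]` joins `p` to `q` or `p'` to `q'`, as the pair of its ends
  -- is uncrossed and no uncrossed pair lies strictly between the two pairs
  have hedge : ∀ u v, G.Adj u v → p ≤ ℓ u → ℓ u ≤ p' → q' ≤ ℓ v → ℓ v ≤ q →
      (ℓ u = p ∧ ℓ v = q) ∨ (ℓ u = p' ∧ ℓ v = q') := by
    intro u v huv h1 h2 h3 h4
    by_contra hcon
    have := hmax (ℓ u) (ℓ v) h1 (by omega) (by omega) h4 (hℓ.uncrossed_of_adj huv)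
    omega
  have hcommon : p' = p ∨ q' = q := by
    by_contra hcon
    have hunc' : Uncrossed G ℓ p q' := by
      intro u v huv h1 h2
      have e1 := hpq u v huv h1 (by omega)
      have e2 := hpq' u v huv
      have e3 := hedge u v huv
      omega
    have := hmax p q' le_rfl hpx hyq' hq'q hunc'
    omega
  rcases hcommon with rfl | rfl
  · have hqq : Uncrossed G ℓ q' q := by
      intro u v huv h1 h2
      have e1 := hpq u v huv (by omega) h2
      have e2 := hpq' v u huv.symm
      have e3 := hedge v u huv.symm
      omega
    have hs' : ∀ i, (![⟨a, p', q, b⟩, ⟨p', x, y, q'⟩, ⟨q', q', q', q⟩] i :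
        Strip).IsValid G n ℓ := by
      intro i
      fin_cases i
      · exact ⟨hap, by simp; omega, hqb, hbn, hunc, hpq⟩
      · exact ⟨hpx, hxy, hyq', by simp; omega, hpq', hxyu⟩
      · exact ⟨le_rfl, le_rfl, hq'q, by simp; omega, hqq, uncrossed_self _⟩
    refine of_cut_three hℓ hs hk hρ {a, p', q', q, b, x, y} [p', q', q, p' + 1, q' + 1, q + 1]
      hs' (fun i ↦ ?_) ?_ ?_ ?_ ?_ ?_ ?_ ?_
    · fin_cases i
      · exact H _ (hs' 0) (by simp [Strip.width]; omega)
      · exact H _ (hs' 1) (by simp [Strip.width]; omega)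
      · exact HI _ _ (hs' 2) (by omega)
    · intro i c hc
      fin_cases i <;> simp [Strip.ends] at hc ⊢ <;> omega
    · intro c hc
      simp [Strip.ends] at hc ⊢; omega
    · intro i c hc
      fin_cases i <;> simp [Strip.starts] at hc ⊢ <;> omega
    · intro i c hc
      fin_cases i <;> simp [Strip.inner] at hc ⊢ <;> omega
    · intro i j hij c hc
      fin_cases i <;> fin_cases j <;> simp [Strip.inner] at hij hc ⊢ <;> omega
    · intro i c hc
      fin_cases i <;> simp [Strip.inner] at hc ⊢ <;> omega
    · intro c hc
      simp [Strip.inner, Fin.exists_fin_succ] at hc ⊢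
      omega
  · have hpp : Uncrossed G ℓ p p' := by
      intro u v huv h1 h2
      have e1 := hpq u v huv h1 (by omega)
      have e2 := hpq' v u huv.symm
      have e3 := hedge u v huv
      omega
    have hs' : ∀ i, (![⟨a, p, q', b⟩, ⟨p', x, y, q'⟩, ⟨p, p, p, p'⟩] i :
        Strip).IsValid G n ℓ := by
      intro i
      fin_cases i
      · exact ⟨hap, by simp; omega, hqb, hbn, hunc, hpq⟩
      · exact ⟨hp'x, hxy, hyq', by simp; omega, hpq', hxyu⟩
      · exact ⟨le_rfl, le_rfl, hpp', by simp; omega, hpp, uncrossed_self _⟩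
    refine of_cut_three hℓ hs hk hρ {a, p, p', q', b, x, y} [p, p', q', p + 1, p' + 1, q' + 1]
      hs' (fun i ↦ ?_) ?_ ?_ ?_ ?_ ?_ ?_ ?_
    · fin_cases i
      · exact H _ (hs' 0) (by simp [Strip.width]; omega)
      · exact H _ (hs' 1) (by simp [Strip.width]; omega)
      · exact HI _ _ (hs' 2) (by omega)
    · intro i c hc
      fin_cases i <;> simp [Strip.ends] at hc ⊢ <;> omega
    · intro c hc
      simp [Strip.ends] at hc ⊢; omega
    · intro i c hc
      fin_cases i <;> simp [Strip.starts] at hc ⊢ <;> omega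
    · intro i c hc
      fin_cases i <;> simp [Strip.inner] at hc ⊢ <;> omega
    · intro i j hij c hc
      fin_cases i <;> fin_cases j <;> simp [Strip.inner] at hij hc ⊢ <;> omega
    · intro i c hc
      fin_cases i <;> simp [Strip.inner] at hc ⊢ <;> omega
    · intro c hc
      simp [Strip.inner, Fin.exists_fin_succ] at hc ⊢
      omega

/-- The depth of the decomposition: twelve new vertices halve the width of a strip. -/
lemma of_width_lt (hℓ : IsPolygonLabelling G n ℓ) (hk : 2 * Fintype.card V ≤ 2 ^ k) (j : ℕ)
    {s : Strip} (hs : s.IsValid G n ℓ) (hW : s.width < 2 ^ (j + 1)) :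
    StripDefinable.{u, w} G ℓ k (k + 1 + 12 * j) s := by
  induction j generalizing s with
  | zero =>
    refine of_inner_eq_empty hℓ hs hk (by omega) ?_
    ext c
    simp only [Strip.inner, Strip.width, Set.mem_union, Set.mem_Ioo, Set.mem_empty_iff_false,
      iff_false] at hW ⊢
    omega
  | succ j ih =>
    have hpow : 2 ^ (j + 1 + 1) = 2 * 2 ^ (j + 1) := pow_succ' 2 (j + 1)
    have H : ∀ s : Strip, s.IsValid G n ℓ → 2 * s.width ≤ 2 ^ (j + 1 + 1) - 1 →
        StripDefinable.{u, w} G ℓ k (k + 1 + 12 * j) s := fun s hs hw ↦ ih hs (by omega)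
    exact of_strip (ρ := k + 1 + 12 * j + 6) hℓ hk (by omega)
      (fun s hs hw ↦ (H s hs hw).mono (by omega) subset_rfl)
      (fun a b hs hw ↦ of_interval hℓ hk (by omega) H hs hw) hs (by omega)

end StripDefinable

/-- A graph with a polygon labelling is defined by a formula of logarithmic quantifier rank: the
vertices numbered `0` and `1` are quantified first, and the others form one strip. -/
theorem IsPolygonLabelling.exists_defines [Fintype V]
    (hℓ : IsPolygonLabelling G (Fintype.card V) ℓ) (h2 : 2 ≤ Fintype.card V) :
    ∃ Φ : GraphFormula 0, GraphFormula.Defines.{u, w} Φ G ∧ Φ.alternationNumber ≤ 2 ∧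
      Φ.quantifierRank + 1 ≤ 13 * Nat.log 2 (Fintype.card V) := by
  obtain ⟨j, hj⟩ : ∃ j, Nat.log 2 (Fintype.card V) = j + 1 :=
    ⟨Nat.log 2 (Fintype.card V) - 1, by
      have := Nat.log_pos (b := 2) (by omega) h2; omega⟩
  have hlt : Fintype.card V < 2 ^ (j + 1 + 1) := by
    rw [← hj]; exact Nat.lt_pow_succ_log_self (by omega) _
  have hk : 2 * Fintype.card V ≤ 2 ^ (j + 3) := by
    rw [show (2 : ℕ) ^ (j + 3) = 2 * 2 ^ (j + 1 + 1) from pow_succ' 2 (j + 1 + 1)]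
    exact Nat.mul_le_mul_left 2 hlt.le
  obtain ⟨v₀, h₀⟩ := hℓ.exists_eq 0 (by omega)
  obtain ⟨v₁, h₁⟩ := hℓ.exists_eq 1 (by omega)
  have hs : (Strip.mk 0 0 0 (Fintype.card V)).IsValid G (Fintype.card V) ℓ :=
    ⟨le_rfl, le_rfl, Nat.zero_le _, le_rfl, hℓ.uncrossed_zero, uncrossed_self 0⟩
  have hdef := StripDefinable.of_interval.{u, w} (k := j + 3) (ρ := j + 3 + 1 + 12 * j) hℓ hk
    (by omega) (W := 2 ^ (j + 1 + 1) - 1)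
    (fun s hs hw ↦ .of_width_lt hℓ hk j hs (by rw [pow_succ'] at hw; omega)) hs (by omega)
  have hP : IsPiece G Set.univ ∅ {v₀} := by
    refine ⟨Set.subset_univ _, by simp, fun _ _ _ _ ↦ Or.inl trivial, fun u _ ↦ ⟨v₀, rfl, ?_⟩⟩
    exact hℓ.reachable_isolate (by omega) fun _ _ _ ↦ trivial
  have heq₀ : ∀ v, ℓ v = 0 → v = v₀ := fun v hv ↦ hℓ.injective (hv.trans h₀.symm)
  have heq₁ : ∀ v, ℓ v = 1 → v = v₁ := fun v hv ↦ hℓ.injective (hv.trans h₁.symm)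
  have hx : ∀ v, ℓ v = 0 ∨ ℓ v = 1 →
      v ∈ Set.range (Fin.snoc (fun _ : Fin 1 ↦ v₀) v₁ : Fin 2 → V) := by
    rintro v (hv | hv)
    · exact ⟨0, by rw [heq₀ v hv]; rfl⟩
    · exact ⟨Fin.last 1, by rw [heq₁ v hv, Fin.snoc_last]⟩
  have hne : ∀ v, ℓ v ≠ Fintype.card V := fun v ↦ (hℓ.lt v).ne
  have hdef' : PieceDefinable.{u, w} G (j + 3) (j + 3 + 1 + 12 * j + 6)
      (Fin.snoc (fun _ : Fin 1 ↦ v₀) v₁ : Fin 2 → V) Set.univ ∅ {v₀} := by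
    refine .of_cut (ι := Unit) (U := ℓ ⁻¹' (Strip.mk 0 0 0 (Fintype.card V)).ends) hP
      (fun _ ↦ hℓ.isPiece hs) (by simp) ?_ (fun _ ↦ ?_) ?_ (fun _ ↦ le_rfl)
      (fun _ ↦ (hℓ.isPiece hs).disjoint) (fun i j h ↦ absurd rfl h) (fun _ ↦ Set.subset_univ _)
      ?_ hk (by omega) fun _ ↦ hdef _ _ ?_
    · intro v hv
      have := hne v
      simp [Strip.ends] at hv
      exact hx v (by omega)
    · intro v hv
      simp [Strip.starts] at hv
      exact hx v (by omega)
    · rintro _ rfl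
      exact hx _ (Or.inl h₀)
    · intro v _
      have := hℓ.lt v
      simp [Strip.ends, Strip.inner]
      omega
    · intro v hv
      have := hne v
      simp [Strip.ends, Strip.starts] at hv
      exact hx v (by omega)
  obtain ⟨Φ, hΦ, hb⟩ := exists_defines_of_pieceDefinable.{u, w} hP hk (by omega)
    (hdef'.of_snoc (by simp) (by rintro _ rfl; exact ⟨0, rfl⟩) (by omega))
  refine ⟨Φ, hΦ, hb.alternationNumber_le, ?_⟩
  have := hb.quantifierRank_le
  omega

end

theorem mainTheorem2 :
    12 / Real.logb 2 (3 / 2) + 1 < (22 : ℝ) ∧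
    ∀ (V : Type u) [Fintype V] (G : SimpleGraph V), HasHamiltonCycle G → Outerplanar G →
      ∃ Φ : GraphFormula 0, GraphFormula.Defines.{u, w} Φ G ∧ Φ.alternationNumber ≤ 2 ∧
        (Φ.quantifierRank : ℝ) <
          (12 / Real.logb 2 (3 / 2) + 1) * Real.logb 2 (Fintype.card V) + 9 := by
  have hlow : (4 : ℝ) / 7 < Real.logb 2 (3 / 2) := by
    rw [Real.lt_logb_iff_rpow_lt (by norm_num) (by norm_num)]
    refine lt_of_pow_lt_pow_left₀ 7 (by norm_num) ?_
    rw [← Real.rpow_natCast, ← Real.rpow_mul (by norm_num)]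
    norm_num
  have hupp : Real.logb 2 (3 / 2) ≤ 1 := by
    rw [Real.logb_le_iff_le_rpow (by norm_num) (by norm_num)]
    norm_num
  refine ⟨?_, fun V _ G hH hO ↦ ?_⟩
  · have : 12 / Real.logb 2 (3 / 2) < 21 := by
      rw [div_lt_iff₀ (by linarith)]
      linarith
    linarith
  · obtain ⟨h2, ℓ, hℓ⟩ := hH.exists_isPolygonLabelling hO
    obtain ⟨Φ, hΦ, halt, hrank⟩ := hℓ.exists_defines.{u, w} h2
    refine ⟨Φ, hΦ, halt, ?_⟩
    have hlog : (Nat.log 2 (Fintype.card V) : ℝ) ≤ Real.logb 2 (Fintype.card V) := by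
      exact_mod_cast Real.natLog_le_logb (Fintype.card V) 2
    have hc : (12 : ℝ) ≤ 12 / Real.logb 2 (3 / 2) := by
      rw [le_div_iff₀ (by linarith)]
      linarith
    have h0 : (0 : ℝ) ≤ Nat.log 2 (Fintype.card V) := Nat.cast_nonneg _
    have hrank' : (Φ.quantifierRank : ℝ) + 1 ≤ 13 * Nat.log 2 (Fintype.card V) := by
      exact_mod_cast hrank
    have hmul : (13 : ℝ) * Real.logb 2 (Fintype.card V) ≤
        (12 / Real.logb 2 (3 / 2) + 1) * Real.logb 2 (Fintype.card V) :=
      mul_le_mul_of_nonneg_right (by linarith) (h0.trans hlog)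
    linarith
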